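/- **Theorem 1.** Let $L$ be a $4$-dimensional real Lie algebra. A *left-invariant Riemannian metric* is an inner product $g$ on $L$, with Levi-Civita connection and Ricci tensor $\mathrm{Ric}$ computed on left-invariant fields, and $d$ is the Chevalley–Eilenberg differential. A *solution* on $L$ is a pair $(g,F)$ with $F\in\Lambda^2L^*$ such that $$Ric_0=-[F\circ F]_0,\qquad dF=0,\qquad d\star F=0,$$ where $(F\circ F)_{ij}=F_{is}F^{s}{}_{j}$, the subscript $0$ denotes the trace-free part, and $\star$ is the Hodge star for an orientation of $L$ (the condition does not depend on which one). It is *non-Einstein* if $Ric_0\neq0$. If $(g,F)$ is a solution, so is $(t^2g,tF)$ for $t>0$. $L$ admits a non-Einstein solution if and only if it has a basis $e_1,\dots,e_4$ in which its nonzero brackets (up to skew-symmetry) are those of one of the following algebras: 1. $2\mathcal A_2$: $[e_1,e_2]=e_2$, $[e_3,e_4]=e_4$; 2. $\mathcal A_2\oplus2\mathcal A_1$: $[e_1,e_2]=e_2$; 3. $\mathcal A_{4,6}^{a,0}$ for some $a\ne0$: $[e_1,e_4]=ae_1$, $[e_2,e_4]=-e_3$, $[e_3,e_4]=e_2$; 4.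 $\mathcal A_{4,9}^{-1/2}$: $[e_2,e_3]=e_1$, $[e_1,e_4]=\tfrac12e_1$, $[e_2,e_4]=e_2$, $[e_3,e_4]=-\tfrac12e_3$. Let $e_1,\dots,e_4$ be such a basis, $e^1,\dots,e^4$ its dual basis, $e^{ij}=e^i\wedge e^j$, and $g_0=\sum_i e^i\otimes e^i$. Up to automorphisms of the Lie algebra and the scaling $(g,F)\mapsto(t^2g,tF)$, $t>0$, the non-Einstein solutions are exactly the following ones, with real coefficients $a_{ij}$: 1. on $2\mathcal A_2$: $g=e^1\otimes e^1+e^2\otimes e^2+a_5\,e^3\otimes e^3+e^4\otimes e^4$, $F=a_{12}e^{12}+a_{34}e^{34}$, with $a_5=\dfrac{1+a_{34}^2}{1+a_{12}^2}\neq1$; 2. on $\mathcal A_2\oplus2\mathcal A_1$: $g=g_0$, $F=a_{12}e^{12}+a_{34}e^{34}$, with $a_{34}^2-a_{12}^2=1$; 3. on $\mathcal A_{4,6}^{a,0}$: $g=g_0$, $F=a_{14}e^{14}+a_{23}e^{23}$, with $a_{23}^2-a_{14}^2=a^2$; 4. on $\mathcal A_{4,9}^{-1/2}$: $g=g_0$,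 $F=a_{13}e^{13}+a_{24}e^{24}$, with $a_{13}^2-a_{24}^2=\tfrac32$. Fix the orientation $e^1\wedge e^2\wedge e^3\wedge e^4$. On the algebras 1–3 the metric of every non-Einstein solution is Kähler for a left-invariant complex structure inducing this orientation. On $\mathcal A_{4,9}^{-1/2}$ the metric $g$ of every non-Einstein solution is strictly almost-Kähler for this orientation: there is a left-invariant almost-Kähler structure $(g,J,\omega)$ that induces the orientation, with $J$ non-integrable and $\mathrm{Ric}$ $J$-invariant, while no left-invariant Kähler structure with metric $g$ induces it. For the reversed orientation $g$ is Kähler for a left-invariant complex structure. -/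

import Mathlib

noncomputable section

namespace EinsteinMaxwell

variable {L : Type*} [LieRing L] [LieAlgebra ℝ L]

/-- A left-invariant Riemannian metric: a positive definite inner product on the Lie algebra. -/
structure Metric (L : Type*) [LieRing L] [LieAlgebra ℝ L] where
  /-- The underlying bilinear form. -/
  form : LinearMap.BilinForm ℝ L
  symm : ∀ x y, form x y = form y x
  pos : ∀ x, x ≠ 0 → 0 < form x x

/-- A left-invariant 2-form `ω` is closed; the left-hand side is `-dω (x, y, z)`, where for
left-invariant forms `d` is the Chevalley–Eilenberg differential (`de^i (x, y) = -e^i [x, y]`). -/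
def ClosedForm (ω : L → L → ℝ) : Prop :=
  ∀ x y z : L, ω ⁅x, y⁆ z + ω ⁅y, z⁆ x + ω ⁅z, x⁆ y = 0

namespace Metric

theorem nondegenerate (g : Metric L) : g.form.Nondegenerate := by
  constructor
  · intro x hx
    by_contra h
    exact (g.pos x h).ne' (hx x)
  · intro x hx
    by_contra h
    exact (g.pos x h).ne' (hx x)

variable [FiniteDimensional ℝ L] (g : Metric L)

/-- Raising an index: `g (♯α) y = α y`. -/
def sharp : Module.Dual ℝ L →ₗ[ℝ] L :=
  ((LinearMap.BilinForm.toDual g.form g.nondegenerate).symm : Module.Dual ℝ L →ₗ[ℝ] L)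

theorem form_sharp (α : Module.Dual ℝ L) (y : L) : g.form (g.sharp α) y = α y :=
  LinearMap.BilinForm.apply_toDual_symm_apply α y

/-- The endomorphism `A` with `g (A x) y = B x y`. -/
def raise (B : LinearMap.BilinForm ℝ L) : L →ₗ[ℝ] L := g.sharp ∘ₗ B

/-- The Koszul functional
`z ↦ (g ([x, y], z) - g (x, [y, z]) - g (y, [x, z])) / 2` for left-invariant fields. -/
def koszul (x y : L) : Module.Dual ℝ L :=
  (1 / 2 : ℝ) • (g.form ⁅x, y⁆ - g.form x ∘ₗ (LieAlgebra.ad ℝ L y : L →ₗ[ℝ] L)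
    - g.form y ∘ₗ (LieAlgebra.ad ℝ L x : L →ₗ[ℝ] L))

/-- The Levi-Civita connection `∇_x y` on left-invariant fields. -/
def nabla : L →ₗ[ℝ] L →ₗ[ℝ] L :=
  LinearMap.mk₂ ℝ (fun x y => g.sharp (g.koszul x y))
    (fun x x' y => by
      rw [← map_add]; congr 1; ext z; simp [koszul]; ring)
    (fun c x y => by
      rw [← map_smul]; congr 1; ext z; simp [koszul]; ring)
    (fun x y y' => by
      rw [← map_add]; congr 1; ext z; simp [koszul]; ring)
    (fun c x y => by
      rw [← map_smul]; congr 1; ext z; simp [koszul]; ring)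

/-- The curvature `R (x, y) = [∇_x, ∇_y] - ∇_[x, y]`. -/
def curvature (x y : L) : L →ₗ[ℝ] L :=
  g.nabla x ∘ₗ g.nabla y - g.nabla y ∘ₗ g.nabla x - g.nabla ⁅x, y⁆

/-- The endomorphism `x ↦ R (x, y) z`. -/
def jacobi (y z : L) : L →ₗ[ℝ] L where
  toFun x := g.curvature x y z
  map_add' x x' := by simp [curvature]; abel
  map_smul' c x := by simp [curvature, smul_sub]

/-- The Ricci tensor `Ric (y, z) = tr (x ↦ R (x, y) z)`. -/
def ricci : LinearMap.BilinForm ℝ L :=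
  LinearMap.mk₂ ℝ (fun y z => LinearMap.trace ℝ L (g.jacobi y z))
    (fun y y' z => by
      rw [← map_add]; congr 1; ext x; simp [jacobi, curvature]; abel)
    (fun c y z => by
      rw [← map_smul]; congr 1; ext x; simp [jacobi, curvature, smul_sub])
    (fun y z z' => by
      rw [← map_add]; congr 1; ext x; simp [jacobi, curvature]; abel)
    (fun c y z => by
      rw [← map_smul]; congr 1; ext x; simp [jacobi, curvature, smul_sub])

/-- The `g`-trace of a bilinear form. -/
def tr (B : LinearMap.BilinForm ℝ L) : ℝ := LinearMap.trace ℝ L (g.raise B)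

/-- The trace-free part of a bilinear form in dimension four. -/
def traceFree (B : LinearMap.BilinForm ℝ L) : LinearMap.BilinForm ℝ L :=
  B - (g.tr B / 4) • g.form

/-- `Ric₀ = Ric - (s / 4) g`, where `s` is the scalar curvature. -/
def ricciZero : LinearMap.BilinForm ℝ L := g.traceFree g.ricci

/-- The metric is Einstein. -/
def IsEinstein : Prop := g.ricciZero = 0

/-- `(F ∘ F)_{ij} = F_{is} F^s_j`. -/
def compSelf (F : LinearMap.BilinForm ℝ L) : LinearMap.BilinForm ℝ L := F ∘ₗ g.raise F

/-- The Riemannian volume form for the orientation in which the basis `e` is positive. -/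
def volumeForm (e : Module.Basis (Fin 4) ℝ L) : L [⋀^Fin 4]→ₗ[ℝ] ℝ :=
  √(Matrix.det (Matrix.of fun i j => g.form (e i) (e j))) • e.det

/-- The Hodge star of a 2-form, `(⋆F)_{kl} = ½ F^{ij} vol_{ijkl}`, for the orientation in which
the basis `e` is positive. -/
def hodgeStar (e : Module.Basis (Fin 4) ℝ L) (F : LinearMap.BilinForm ℝ L) (x y : L) : ℝ :=
  (1 / 2 : ℝ) * ∑ i, ∑ j, F (g.sharp (e.coord i)) (g.sharp (e.coord j)) *
    g.volumeForm e ![e i, e j, x, y]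

end Metric

/-- `(g, F)` is a non-Einstein solution of the Einstein–Maxwell equations
`Ric₀ = -[F ∘ F]₀`, `dF = 0`, `d⋆F = 0`, for the orientation given by the basis `e`. -/
structure IsSolution [FiniteDimensional ℝ L] (g : Metric L) (e : Module.Basis (Fin 4) ℝ L)
    (F : LinearMap.BilinForm ℝ L) : Prop where
  alt : ∀ x, F x x = 0
  einstein_maxwell : g.ricciZero = -g.traceFree (g.compSelf F)
  closed : ClosedForm fun x y => F x y
  coclosed : ClosedForm (g.hodgeStar e F)
  not_einstein : ¬ g.IsEinstein

/-- `J` is a left-invariant `g`-orthogonal almost-complex structure whose fundamental form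
`ω (x, y) = g (J x, y)` is closed and satisfies `ω ∧ ω > 0` with respect to the orientation given
by the basis `e`, i.e. `(g, J, ω)` is an almost-Kähler structure inducing that orientation. -/
structure IsAlmostKahler (g : Metric L) (e : Module.Basis (Fin 4) ℝ L) (J : L →ₗ[ℝ] L) :
    Prop where
  sq : ∀ x, J (J x) = -x
  orthogonal : ∀ x y, g.form (J x) (J y) = g.form x y
  closed : ClosedForm fun x y => g.form (J x) y
  oriented : 0 < g.form (J (e 0)) (e 1) * g.form (J (e 2)) (e 3)
    - g.form (J (e 0)) (e 2) * g.form (J (e 1)) (e 3)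
    + g.form (J (e 0)) (e 3) * g.form (J (e 1)) (e 2)

/-- The Nijenhuis tensor of `J` vanishes. -/
def IsIntegrable (J : L →ₗ[ℝ] L) : Prop :=
  ∀ x y : L, ⁅J x, J y⁆ - J ⁅J x, y⁆ - J ⁅x, J y⁆ - ⁅x, y⁆ = 0

/-- `(g, J)` is a left-invariant Kähler structure inducing the orientation given by `e`. -/
def IsKahler (g : Metric L) (e : Module.Basis (Fin 4) ℝ L) (J : L →ₗ[ℝ] L) : Prop :=
  IsAlmostKahler g e J ∧ IsIntegrable J

/-- The brackets `[e₁, e₂]`, `[e₁, e₃]`, `[e₁, e₄]`, `[e₂, e₃]`, `[e₂, e₄]`, `[e₃, e₄]` of a basis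
(indexed from `0` in Lean) are the given vectors, in this order. -/
def HasBrackets (e : Module.Basis (Fin 4) ℝ L) (v₁₂ v₁₃ v₁₄ v₂₃ v₂₄ v₃₄ : L) : Prop :=
  ⁅e 0, e 1⁆ = v₁₂ ∧ ⁅e 0, e 2⁆ = v₁₃ ∧ ⁅e 0, e 3⁆ = v₁₄ ∧
  ⁅e 1, e 2⁆ = v₂₃ ∧ ⁅e 1, e 3⁆ = v₂₄ ∧ ⁅e 2, e 3⁆ = v₃₄

/-- `2A₂`: `[e₁, e₂] = e₂`, `[e₃, e₄] = e₄`. -/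
def IsTwoA2 (e : Module.Basis (Fin 4) ℝ L) : Prop :=
  HasBrackets e (e 1) 0 0 0 0 (e 3)

/-- `A₂ ⊕ 2A₁`: `[e₁, e₂] = e₂`. -/
def IsA2Sum2A1 (e : Module.Basis (Fin 4) ℝ L) : Prop :=
  HasBrackets e (e 1) 0 0 0 0 0

/-- `A_{4,6}^{a,0}`: `[e₁, e₄] = a e₁`, `[e₂, e₄] = -e₃`, `[e₃, e₄] = e₂`. -/
def IsA46 (a : ℝ) (e : Module.Basis (Fin 4) ℝ L) : Prop :=
  HasBrackets e 0 0 (a • e 0) 0 (-e 2) (e 1)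

/-- `A_{4,9}^{-1/2}`: `[e₂, e₃] = e₁`, `[e₁, e₄] = ½ e₁`, `[e₂, e₄] = e₂`, `[e₃, e₄] = -½ e₃`. -/
def IsA49 (e : Module.Basis (Fin 4) ℝ L) : Prop :=
  HasBrackets e 0 0 ((1 / 2 : ℝ) • e 0) (e 0) (e 1) (-(1 / 2 : ℝ) • e 2)

/-- The matrix of `e^i ∧ e^j`. -/
def wedge (i j : Fin 4) : Matrix (Fin 4) (Fin 4) ℝ :=
  Matrix.single i j 1 - Matrix.single j i 1

/-- Up to an automorphism of the Lie algebra and a scaling `(g, F) ↦ (t² g, t F)`, the metric `g`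
and the form `F` have the matrices `G` and `Φ` in the basis `e`. -/
def EquivTo (g : Metric L) (F : LinearMap.BilinForm ℝ L) (e : Module.Basis (Fin 4) ℝ L)
    (G Φ : Matrix (Fin 4) (Fin 4) ℝ) : Prop :=
  ∃ φ : L ≃ₗ⁅ℝ⁆ L, ∃ t : ℝ, 0 < t ∧
    (∀ i j, g.form (φ (e i)) (φ (e j)) = t ^ 2 * G i j) ∧
    (∀ i j, F (φ (e i)) (φ (e j)) = t * Φ i j)

end EinsteinMaxwell
end

open EinsteinMaxwell

/-! In a suitable orthonormal frame F = α h¹² + β h³⁴. Then −[F∘F]₀ = ½(α² − β²) diag(1, 1, −1, −1),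
so non-Einstein means α² ≠ β². The Hodge star exchanges α and β up to a common sign, so dF = 0 and
d⋆F = 0 form an invertible linear system in dh¹² and dh³⁴: both plane forms are closed
(`IsSolution.exists_adapted`). Hence both planes are subalgebras, each acting on the quotient by
itself with zero trace. Rotations inside the planes leave fourteen structure constants
(`IsAdapted.exists_aligned`), constrained by the Jacobi identity and by the Ricci tensor being
diagonal with equal entries on each plane.

The classification depends on which planes are abelian. If neither is, all mixed brackets vanish and
L is a product of two nonabelian planes (`eq_zero_of_nonabelian_planes`). If both are, the Ricci
conditions give α² = β², a contradiction (`false_of_abelian_planes`). If only ⟨h₃, h₄⟩ is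
nonabelian, with [h₃, h₄] = b h₄, let A and B be the actions of h₃ and h₄ on the quotient by this
plane. Then [A, B] = bB, so B is nilpotent. For B = 0, h₃ acts as an infinitesimal rotation
(`exists_rotationFrame`); for B ≠ 0 a Heisenberg ideal appears (`exists_heisenbergFrame`).

Rescaling the frame vectors yields the standard bases. Which kind of frame occurs on a given algebra
is decided by comparing the Killing form with the square of x ↦ tr ad x (`HasKillingRatio`).

Closedness of both plane forms makes h¹² ± h³⁴ symplectic, which gives almost-Kähler structures for
both orientations. They are integrable for product and rotation frames. For Heisenberg frames only
the negative one is, and a positively oriented almost-Kähler structure must be ± the standard one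
(`IsHeisenbergFrame.not_isKahler`). Automorphisms of the fourth algebra preserve orientation
(`IsA49.det_pos`), so the two cases are not confused. -/

namespace EinsteinMaxwell

open Module

variable {L : Type*} [LieRing L] [LieAlgebra ℝ L]

/-- The basis `h` is orthonormal for the metric `g`. -/
def IsOrtho (g : Metric L) (h : Basis (Fin 4) ℝ L) : Prop :=
  ∀ i j, g.form (h i) (h j) = if i = j then 1 else 0

/-! ### Traces, connection and Ricci tensor in an orthonormal frame -/

namespace IsOrtho

variable {g : Metric L} {h : Basis (Fin 4) ℝ L}

theorem repr_apply (H : IsOrtho g h) (v : L) (i : Fin 4) : h.repr v i = g.form v (h i) := by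
  conv_rhs => rw [← h.sum_repr v, map_sum, LinearMap.sum_apply]
  simp only [map_smul, LinearMap.smul_apply, H _ _]
  simp

theorem sum_form (H : IsOrtho g h) (v : L) : ∑ i, g.form v (h i) • h i = v := by
  conv_rhs => rw [← h.sum_repr v]
  simp [H.repr_apply]

theorem ext (H : IsOrtho g h) {v w : L} (hvw : ∀ i, g.form v (h i) = g.form w (h i)) : v = w := by
  rw [← H.sum_form v, ← H.sum_form w]
  simp [hvw]

theorem trace_eq (H : IsOrtho g h) (A : L →ₗ[ℝ] L) :
    LinearMap.trace ℝ L A = ∑ i, g.form (A (h i)) (h i) := by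
  rw [LinearMap.trace_eq_matrix_trace ℝ h, Matrix.trace]
  simp [LinearMap.toMatrix_apply, H.repr_apply]

variable [FiniteDimensional ℝ L]

theorem form_raise (g : Metric L) (B : LinearMap.BilinForm ℝ L) (x y : L) :
    g.form (g.raise B x) y = B x y :=
  g.form_sharp _ _

theorem raise_eq (H : IsOrtho g h) (B : LinearMap.BilinForm ℝ L) (x : L) :
    g.raise B x = ∑ i, B x (h i) • h i := by
  rw [← H.sum_form (g.raise B x)]
  simp [form_raise]

theorem sharp_eq (H : IsOrtho g h) (α : Dual ℝ L) : g.sharp α = ∑ i, α (h i) • h i := by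
  rw [← H.sum_form (g.sharp α)]
  simp [g.form_sharp]

theorem tr_eq (H : IsOrtho g h) (B : LinearMap.BilinForm ℝ L) : g.tr B = ∑ i, B (h i) (h i) := by
  rw [Metric.tr, H.trace_eq]
  simp [form_raise]

theorem compSelf_eq (H : IsOrtho g h) (F : LinearMap.BilinForm ℝ L) (x y : L) :
    g.compSelf F x y = ∑ i, F x (h i) * F (h i) y := by
  simp [Metric.compSelf, H.raise_eq]

theorem form_nabla (g : Metric L) (x y z : L) :
    g.form (g.nabla x y) z = (g.form ⁅x, y⁆ z - g.form ⁅y, z⁆ x - g.form ⁅x, z⁆ y) / 2 := by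
  simp only [Metric.nabla, LinearMap.mk₂_apply, g.form_sharp, Metric.koszul]
  simp [g.symm x, g.symm y]
  ring

theorem form_nabla_nabla (H : IsOrtho g h) (x y z w : L) :
    g.form (g.nabla x (g.nabla y z)) w =
      ∑ m, g.form (g.nabla y z) (h m) * g.form (g.nabla x (h m)) w := by
  conv_lhs => rw [← H.sum_form (g.nabla y z)]
  simp [map_sum]

theorem form_nabla_bracket (H : IsOrtho g h) (x y z w : L) :
    g.form (g.nabla ⁅x, y⁆ z) w = ∑ m, g.form ⁅x, y⁆ (h m) * g.form (g.nabla (h m) z) w := by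
  conv_lhs => rw [← H.sum_form ⁅x, y⁆]
  simp [map_sum]

/-- The Ricci tensor in an orthonormal frame, through the connection coefficients. -/
theorem ricci_eq (H : IsOrtho g h) (y z : L) :
    g.ricci y z = ∑ k, ∑ m,
      (g.form (g.nabla y z) (h m) * g.form (g.nabla (h k) (h m)) (h k) -
        g.form (g.nabla (h k) z) (h m) * g.form (g.nabla y (h m)) (h k) -
        g.form ⁅h k, y⁆ (h m) * g.form (g.nabla (h m) z) (h k)) := by
  simp only [Metric.ricci, LinearMap.mk₂_apply]
  rw [H.trace_eq]
  refine Finset.sum_congr rfl fun k _ => ?_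
  simp only [Metric.jacobi, Metric.curvature, LinearMap.coe_mk, AddHom.coe_mk, LinearMap.sub_apply,
    LinearMap.comp_apply, map_sub, H.form_nabla_nabla, H.form_nabla_bracket, Finset.sum_sub_distrib]

/-- The structure constants `c i j k = g ([h i, h j], h k)`. -/
theorem ricci_frame (H : IsOrtho g h) (c : Fin 4 → Fin 4 → Fin 4 → ℝ)
    (hc : ∀ i j k, g.form ⁅h i, h j⁆ (h k) = c i j k) (i j : Fin 4) :
    g.ricci (h i) (h j) = ∑ k, ∑ m,
      ((c i j m - c j m i - c i m j) / 2 * ((c k m k - c m k k - c k k m) / 2) -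
        (c k j m - c j m k - c k m j) / 2 * ((c i m k - c m k i - c i k m) / 2) -
        c k i m * ((c m j k - c j k m - c m k j) / 2)) := by
  rw [H.ricci_eq]
  simp only [form_nabla, hc]

end IsOrtho

end EinsteinMaxwell

/-! ### Ricci tensor and Jacobi identity of the fourteen-parameter brackets -/

namespace EinsteinMaxwell

open Module

variable {L : Type*} [LieRing L] [LieAlgebra ℝ L]

theorem IsOrtho.jacobi_frame {g : Metric L} {h : Basis (Fin 4) ℝ L} (H : IsOrtho g h)
    (c : Fin 4 → Fin 4 → Fin 4 → ℝ)
    (hc : ∀ i j k, g.form ⁅h i, h j⁆ (h k) = c i j k) (i j k l : Fin 4) :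
    ∑ m, (c j k m * c i m l + c k i m * c j m l + c i j m * c k m l) = 0 := by
  have key : ∀ x y z w : Fin 4, g.form ⁅h x, ⁅h y, h z⁆⁆ (h w) = ∑ m, c y z m * c x m w := by
    intro x y z w
    conv_lhs => rw [← H.sum_form ⁅h y, h z⁆]
    simp [lie_sum, hc]
  have := congrArg (fun v => g.form v (h l)) (lie_jacobi (h i) (h j) (h k))
  simpa [key, Finset.sum_add_distrib] using this

/-- The brackets of a basis whose coordinate planes `h₁ h₂` and `h₃ h₄` are subalgebras acting on
each other, modulo themselves, by trace-free endomorphisms, and whose vectors `h₂` and `h₄` span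
ideals of these subalgebras. -/
def HasFrameBrackets (h : Basis (Fin 4) ℝ L) (a b p q r s t u P Q R S T U : ℝ) : Prop :=
  HasBrackets h (a • h 1)
    (-p • h 0 - r • h 1 + P • h 2 + R • h 3) (-s • h 0 - u • h 1 + Q • h 2 - P • h 3)
    (-q • h 0 + p • h 1 + S • h 2 + U • h 3) (-t • h 0 + s • h 1 + T • h 2 - S • h 3)
    (b • h 3)

/-- The structure constants of `HasFrameBrackets`. -/
def frameConst (a b p q r s t u P Q R S T U : ℝ) : Fin 4 → Fin 4 → Fin 4 → ℝ :=
  ![![![0, 0, 0, 0], ![0, a, 0, 0], ![-p, -r, P, R], ![-s, -u, Q, -P]],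
    ![![0, -a, 0, 0], ![0, 0, 0, 0], ![-q, p, S, U], ![-t, s, T, -S]],
    ![![p, r, -P, -R], ![q, -p, -S, -U], ![0, 0, 0, 0], ![0, 0, 0, b]],
    ![![s, u, -Q, P], ![t, -s, -T, S], ![0, 0, 0, -b], ![0, 0, 0, 0]]]

/-- The Ricci tensor for `HasFrameBrackets`. -/
noncomputable def frameRicci (a b p q r s t u P Q R S T U : ℝ) : Matrix (Fin 4) (Fin 4) ℝ :=
  !![-2 * P ^ 2 - 1 / 2 * Q ^ 2 - Q * R - 1 / 2 * R ^ 2 - a ^ 2 - b * p + 1 / 2 * q ^ 2 -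
       1 / 2 * r ^ 2 + 1 / 2 * t ^ 2 - 1 / 2 * u ^ 2,
     -2 * P * S - 1 / 2 * Q * T - 1 / 2 * Q * U - 1 / 2 * R * T - 1 / 2 * R * U -
       1 / 2 * b * q - 1 / 2 * b * r - p * q + p * r - s * t + s * u,
     P * b - P * p - 1 / 2 * Q * s - 1 / 2 * R * s - 1 / 2 * S * q - 1 / 2 * S * r -
       1 / 2 * T * t - 1 / 2 * U * u + 2 * a * p,
     P * s - 1 / 2 * Q * p + R * b - 1 / 2 * R * p + 1 / 2 * S * t + 1 / 2 * S * u -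
       1 / 2 * T * r - 1 / 2 * U * q + 2 * a * s;
     -2 * P * S - 1 / 2 * Q * T - 1 / 2 * Q * U - 1 / 2 * R * T - 1 / 2 * R * U -
       1 / 2 * b * q - 1 / 2 * b * r - p * q + p * r - s * t + s * u,
     -2 * S ^ 2 - 1 / 2 * T ^ 2 - T * U - 1 / 2 * U ^ 2 - a ^ 2 + b * p - 1 / 2 * q ^ 2 +
       1 / 2 * r ^ 2 - 1 / 2 * t ^ 2 + 1 / 2 * u ^ 2,
     -1 / 2 * P * q - 1 / 2 * P * r - 1 / 2 * Q * u - 1 / 2 * R * t + S * b + S * p +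
       1 / 2 * T * s + 1 / 2 * U * s + a * q + a * r,
     1 / 2 * P * t + 1 / 2 * P * u - 1 / 2 * Q * q - 1 / 2 * R * r - S * s + 1 / 2 * T * p +
       U * b + 1 / 2 * U * p + a * t + a * u;
     2 * P * b - P * p - 1 / 2 * Q * s - 1 / 2 * R * s - 1 / 2 * S * q - 1 / 2 * S * r -
       1 / 2 * T * t - 1 / 2 * U * u + a * p,
     -1 / 2 * P * q - 1 / 2 * P * r - 1 / 2 * Q * u - 1 / 2 * R * t + 2 * S * b + S * p +
       1 / 2 * T * s + 1 / 2 * U * s + a * r,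
     -P * a + 1 / 2 * Q ^ 2 - 1 / 2 * R ^ 2 + 1 / 2 * T ^ 2 - 1 / 2 * U ^ 2 - b ^ 2 -
       2 * p ^ 2 - 1 / 2 * q ^ 2 - q * r - 1 / 2 * r ^ 2,
     -P * Q + P * R - 1 / 2 * Q * a - 1 / 2 * R * a - S * T + S * U - 2 * p * s -
       1 / 2 * q * t - 1 / 2 * q * u - 1 / 2 * r * t - 1 / 2 * r * u;
     P * s + Q * b - 1 / 2 * Q * p + R * b - 1 / 2 * R * p + 1 / 2 * S * t + 1 / 2 * S * u -
       1 / 2 * T * r - 1 / 2 * U * q + a * s,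
     1 / 2 * P * t + 1 / 2 * P * u - 1 / 2 * Q * q - 1 / 2 * R * r - S * s + T * b +
       1 / 2 * T * p + U * b + 1 / 2 * U * p + a * u,
     -P * Q + P * R - 1 / 2 * Q * a - 1 / 2 * R * a - S * T + S * U - 2 * p * s -
       1 / 2 * q * t - 1 / 2 * q * u - 1 / 2 * r * t - 1 / 2 * r * u,
     P * a - 1 / 2 * Q ^ 2 + 1 / 2 * R ^ 2 - 1 / 2 * T ^ 2 + 1 / 2 * U ^ 2 - b ^ 2 - 2 * s ^ 2 -
       1 / 2 * t ^ 2 - t * u - 1 / 2 * u ^ 2]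

variable {g : Metric L} {h : Basis (Fin 4) ℝ L} {a b p q r s t u P Q R S T U : ℝ}

theorem HasFrameBrackets.form_lie (H : IsOrtho g h)
    (hb : HasFrameBrackets h a b p q r s t u P Q R S T U) (i j k : Fin 4) :
    g.form ⁅h i, h j⁆ (h k) = frameConst a b p q r s t u P Q R S T U i j k := by
  obtain ⟨h01, h02, h03, h12, h13, h23⟩ := hb
  have h10 := (lie_skew (h 1) (h 0)).symm
  have h20 := (lie_skew (h 2) (h 0)).symm
  have h30 := (lie_skew (h 3) (h 0)).symm
  have h21 := (lie_skew (h 2) (h 1)).symm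
  have h31 := (lie_skew (h 3) (h 1)).symm
  have h32 := (lie_skew (h 3) (h 2)).symm
  rw [h01] at h10
  rw [h02] at h20
  rw [h03] at h30
  rw [h12] at h21
  rw [h13] at h31
  rw [h23] at h32
  fin_cases i <;> fin_cases j <;>
    simp only [Fin.reduceFinMk, Fin.zero_eta, Fin.mk_one, Fin.isValue, lie_self, h01, h02, h03, h12,
      h13, h23, h10, h20, h30, h21, h31, h32] <;>
    fin_cases k <;> simp [H _ _, frameConst]

-- The trace is evaluated without the Jacobi identity, so `frameRicci` is not formally symmetric:
-- for instance its entries 02 and 20 differ by bP − ap, which vanishes by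
-- `HasFrameBrackets.jacobi`.
set_option maxHeartbeats 1000000 in
theorem HasFrameBrackets.ricci_eq [FiniteDimensional ℝ L] (H : IsOrtho g h)
    (hb : HasFrameBrackets h a b p q r s t u P Q R S T U) (i j : Fin 4) :
    g.ricci (h i) (h j) = frameRicci a b p q r s t u P Q R S T U i j := by
  rw [H.ricci_frame _ (hb.form_lie H)]
  fin_cases i <;> fin_cases j <;>
    simp [Fin.sum_univ_four, frameConst, frameRicci] <;> ring

/-- The Jacobi identity for `HasFrameBrackets`. -/
theorem HasFrameBrackets.jacobi (H : IsOrtho g h)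
    (hb : HasFrameBrackets h a b p q r s t u P Q R S T U) :
    (b * Q = a * s ∧ b * P = a * p ∧ b * T = a * t ∧ b * S = a * q) ∧
    (q * u - r * t = b * s ∧ 2 * (r * s - p * u) = b * u ∧ 2 * (p * t - q * s) = b * t) ∧
    (Q * U - R * T = a * S ∧ 2 * (R * S - P * U) = a * U ∧ 2 * (P * T - Q * S) = a * T) ∧
    (P * q + R * t - S * p - U * s + a * q = 0 ∧ P * p + R * s + S * r + U * u + a * p = 0 ∧
      P * t - Q * q - S * s + T * p - a * t = 0 ∧ P * s - Q * p + S * u - T * r - a * s = 0) := by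
  -- With A = (p q; r −p) and B = (s t; u −s) the actions of h₃ and h₄ on the quotient by their
  -- plane, the second group of identities is [A, B] = bB. The third group is the same statement for
  -- h₁, h₂ and the matrices (P Q; R −P), (S T; U −S).
  have J := H.jacobi_frame _ (hb.form_lie H)
  have e1 := J 0 1 2 0
  have e2 := J 0 1 2 1
  have e3 := J 0 1 2 2
  have e4 := J 0 1 2 3
  have e5 := J 0 1 3 0
  have e6 := J 0 1 3 1
  have e7 := J 0 1 3 2
  have e9 := J 0 2 3 0
  have e10 := J 0 2 3 1
  have e11 := J 0 2 3 2
  have e12 := J 0 2 3 3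
  have e13 := J 1 2 3 0
  have e15 := J 1 2 3 2
  have e16 := J 1 2 3 3
  simp [Fin.sum_univ_four, frameConst] at e1 e2 e3 e4 e5 e6 e7 e9 e10 e11 e12 e13 e15 e16
  refine ⟨⟨?_, ?_, ?_, ?_⟩, ⟨?_, ?_, ?_⟩, ⟨?_, ?_, ?_⟩, ⟨?_, ?_, ?_, ?_⟩⟩ <;> linarith

end EinsteinMaxwell

/-! ### Normal form of a 2-form and its Hodge star -/

namespace EinsteinMaxwell

open Module

variable {L : Type*} [LieRing L] [LieAlgebra ℝ L]

/-- The inner product given by a metric. -/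
abbrev Metric.core (g : Metric L) : InnerProductSpace.Core ℝ L where
  inner x y := g.form x y
  conj_inner_symm x y := by simp [g.symm x y]
  re_inner_nonneg x := by
    rcases eq_or_ne x 0 with rfl | hx
    · simp
    · simpa using (g.pos x hx).le
  add_left x y z := by simp
  smul_left x y c := by simp
  definite x hx := by
    by_contra h
    exact (g.pos x h).ne' hx

/-- `F = α h¹² + β h³⁴` -/
structure IsNormalForm (F : LinearMap.BilinForm ℝ L) (h : Basis (Fin 4) ℝ L) (α β : ℝ) : Prop where
  alt : ∀ x, F x x = 0
  f01 : F (h 0) (h 1) = α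
  f02 : F (h 0) (h 2) = 0
  f03 : F (h 0) (h 3) = 0
  f12 : F (h 1) (h 2) = 0
  f13 : F (h 1) (h 3) = 0
  f23 : F (h 2) (h 3) = β

theorem apply_swap_of_alt {F : LinearMap.BilinForm ℝ L} (hF : ∀ x, F x x = 0) (x y : L) :
    F x y = -F y x := by
  have := hF (x + y)
  simp [hF] at this
  linarith

variable [FiniteDimensional ℝ L]

/-- A 2-form on a 4-dimensional inner product space has a normal form in some orthonormal basis. -/
theorem exists_normalForm (hL : finrank ℝ L = 4) (g : Metric L) (F : LinearMap.BilinForm ℝ L)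
    (hF : ∀ x, F x x = 0) :
    ∃ (h : Basis (Fin 4) ℝ L) (α β : ℝ), IsOrtho g h ∧ IsNormalForm F h α β := by
  let : NormedAddCommGroup L := g.core.toNormedAddCommGroup
  let : InnerProductSpace ℝ L := InnerProductSpace.ofCore g.core.toCore
  have hin : ∀ x y : L, inner ℝ x y = g.form x y := fun _ _ => rfl
  have hsk := apply_swap_of_alt hF
  set A := g.raise F
  have hA : ∀ x y, g.form (A x) y = F x y := IsOrtho.form_raise g F
  -- A is skew, so A² is symmetric. If x is an eigenvector of A² with Ax ≠ 0, the plane of x and Ax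
  -- is A-invariant, and F has no component between it and its orthogonal complement.
  have hS : (A ∘ₗ A).IsSymmetric := by
    intro x y
    rw [hin, hin, LinearMap.comp_apply, LinearMap.comp_apply, hA, hsk, ← hA, g.symm x, hA,
      ← hA, g.symm (A y), hA, hsk, neg_neg,
      ← hA]
  set v := hS.eigenvectorBasis hL
  have hv : ∀ i, A (A (v i)) = hS.eigenvalues hL i • v i :=
    fun i => hS.apply_eigenvectorBasis hL i
  have ortho : ∀ b : OrthonormalBasis (Fin 4) ℝ L, IsOrtho g b.toBasis := by
    intro b i j
    simpa [hin] using orthonormal_iff_ite.mp b.orthonormal i j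
  by_cases h0 : ∀ i, A (v i) = 0
  · have hF0 : ∀ i j, F (v i) (v j) = 0 := fun i j => by rw [← hA, h0]; simp
    exact ⟨v.toBasis, 0, 0, ortho v, hF, by simp [hF0], by simp [hF0], by simp [hF0], by simp [hF0],
      by simp [hF0], by simp [hF0]⟩
  · push Not at h0
    obtain ⟨i, hi⟩ := h0
    set x := v i
    have hx : ‖x‖ = 1 := v.norm_eq_one i
    have hn : ‖A x‖ ≠ 0 := norm_ne_zero_iff.mpr hi
    set w : L := ‖A x‖⁻¹ • A x with hw
    have hw1 : ‖w‖ = 1 := by rw [hw, norm_smul]; simp [hn]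
    have hxw : inner ℝ x w = 0 := by
      rw [hw, inner_smul_right, real_inner_comm, hin, hA, hF, mul_zero]
    -- The zeros are placeholders: only the indices 0 and 1 are prescribed, and the extension
    -- supplies the rest.
    have hon : Orthonormal ℝ (({0, 1} : Set (Fin 4)).domRestrict ![x, w, 0, 0]) := by
      rw [orthonormal_iff_ite]
      rintro ⟨j, hj⟩ ⟨k, hk⟩
      have hwx : inner ℝ w x = 0 := by rw [real_inner_comm, hxw]
      obtain rfl | rfl : j = 0 ∨ j = 1 := by simpa using hj
      all_goals obtain rfl | rfl : k = 0 ∨ k = 1 := by simpa using hk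
      all_goals simp [hxw, hwx, hx, hw1, -inner_self_eq_norm_sq_to_K, real_inner_self_eq_norm_sq]
    obtain ⟨b, hb⟩ := hon.exists_orthonormalBasis_extension_of_card_eq (by simpa using hL)
    have hb0 : b 0 = x := by simpa using hb 0 (by simp)
    have hb1 : b 1 = w := by simpa using hb 1 (by simp)
    have h2 : ∀ k, k ≠ 0 → k ≠ 1 → F (b 0) (b k) = 0 ∧ F (b 1) (b k) = 0 := by
      intro k hk0 hk1
      have e0 := orthonormal_iff_ite.mp b.orthonormal 0 k
      have e1 := orthonormal_iff_ite.mp b.orthonormal 1 k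
      rw [if_neg hk0.symm, hb0, hin] at e0
      rw [if_neg hk1.symm, hb1, hin] at e1
      refine ⟨?_, ?_⟩
      · rw [hb0, ← hA]
        rw [hw, map_smul, LinearMap.smul_apply, smul_eq_mul] at e1
        exact (mul_eq_zero.mp e1).resolve_left (inv_ne_zero hn)
      · rw [hb1, ← hA, hw, map_smul, hv]
        simp only [map_smul, LinearMap.smul_apply]
        rw [e0]
        simp
    exact ⟨b.toBasis, _, _, ortho b, hF, rfl, by simp [h2], by simp [h2], by simp [h2],
      by simp [h2], rfl⟩

/-- The form `h^i ∧ h^j`. -/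
noncomputable def planeForm (g : Metric L) (h : Basis (Fin 4) ℝ L) (i j : Fin 4) (x y : L) : ℝ :=
  g.form x (h i) * g.form y (h j) - g.form x (h j) * g.form y (h i)

namespace IsNormalForm

variable {g : Metric L} {F : LinearMap.BilinForm ℝ L} {h : Basis (Fin 4) ℝ L} {α β : ℝ}

omit [FiniteDimensional ℝ L] in
theorem apply_basis (N : IsNormalForm F h α β) (i j : Fin 4) :
    F (h i) (h j) = (α • wedge 0 1 + β • wedge 2 3) i j := by
  have hsk := apply_swap_of_alt N.alt
  fin_cases i <;> fin_cases j <;>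
    simp [N.alt, N.f01, N.f02, N.f03, N.f12, N.f13, N.f23, hsk (h 1) (h 0), hsk (h 2) (h 0),
      hsk (h 3) (h 0), hsk (h 2) (h 1), hsk (h 3) (h 1), hsk (h 3) (h 2), wedge, Matrix.single]

omit [FiniteDimensional ℝ L] in
theorem apply_eq (H : IsOrtho g h) (N : IsNormalForm F h α β) (x y : L) :
    F x y = α * planeForm g h 0 1 x y + β * planeForm g h 2 3 x y := by
  conv_lhs => rw [← H.sum_form x, ← H.sum_form y]
  simp [Fin.sum_univ_four, N.apply_basis, wedge, planeForm, Matrix.single]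
  ring

theorem compSelf_basis (H : IsOrtho g h) (N : IsNormalForm F h α β) (i j : Fin 4) :
    g.compSelf F (h i) (h j) = -Matrix.diagonal ![α ^ 2, α ^ 2, β ^ 2, β ^ 2] i j := by
  rw [H.compSelf_eq]
  simp only [N.apply_basis, Fin.sum_univ_four]
  fin_cases i <;> fin_cases j <;> simp [wedge, Matrix.single] <;> ring

theorem neg_traceFree_compSelf (H : IsOrtho g h) (N : IsNormalForm F h α β) (i j : Fin 4) :
    (-g.traceFree (g.compSelf F)) (h i) (h j) =
      Matrix.diagonal ![(α ^ 2 - β ^ 2) / 2, (α ^ 2 - β ^ 2) / 2, (β ^ 2 - α ^ 2) / 2,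
        (β ^ 2 - α ^ 2) / 2] i j := by
  simp only [Metric.traceFree, H.tr_eq, N.compSelf_basis H, LinearMap.neg_apply,
    LinearMap.sub_apply, LinearMap.smul_apply, H _ _, Fin.sum_univ_four]
  fin_cases i <;> fin_cases j <;> simp <;> ring

omit [FiniteDimensional ℝ L] in
theorem _root_.EinsteinMaxwell.det_mul_det (e h : Basis (Fin 4) ℝ L) : e.det h * h.det e = 1 := by
  have := congrArg (fun D : L [⋀^Fin 4]→ₗ[ℝ] ℝ => D e) (e.det.eq_smul_basis_det h)
  rw [e.det_self] at this
  simpa using this.symm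

omit [FiniteDimensional ℝ L] in
/-- The volume form in an orthonormal frame. -/
theorem _root_.EinsteinMaxwell.IsOrtho.volumeForm_eq (H : IsOrtho g h) (e : Basis (Fin 4) ℝ L) :
    ∃ ε : ℝ, ε ^ 2 = 1 ∧ g.volumeForm e = ε • h.det := by
  have hgram : (Matrix.of fun i j => g.form (e i) (e j)) = (h.toMatrix e).transpose * h.toMatrix e := by
    ext i j
    conv_lhs => rw [Matrix.of_apply, ← H.sum_form (e j)]
    simp [Matrix.mul_apply, Basis.toMatrix_apply, H.repr_apply, mul_comm]
  have hdet : √(Matrix.of fun i j => g.form (e i) (e j)).det = |h.det e| := by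
    rw [hgram, Matrix.det_mul, Matrix.det_transpose, ← Basis.det_apply, Real.sqrt_mul_self_eq_abs]
  have he : e.det = e.det h • h.det := e.det.eq_smul_basis_det h
  have h1 := det_mul_det e h
  refine ⟨|h.det e| * e.det h, ?_, ?_⟩
  · rw [mul_pow, sq_abs]
    linear_combination (e.det h * h.det e + 1) * h1
  · rw [Metric.volumeForm, hdet, mul_smul, ← he]

/-- Contraction with the inverse metric. -/
theorem _root_.EinsteinMaxwell.IsOrtho.sum_sharp (H : IsOrtho g h) (e : Basis (Fin 4) ℝ L)
    (φ ψ : Dual ℝ L) :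
    ∑ i, φ (g.sharp (e.coord i)) * ψ (e i) = ∑ k, φ (h k) * ψ (h k) := by
  simp only [H.sharp_eq, map_sum, map_smul, smul_eq_mul, Finset.sum_mul]
  rw [Finset.sum_comm]
  refine Finset.sum_congr rfl fun k _ => ?_
  conv_rhs => rw [← e.sum_repr (h k)]
  conv_rhs => rw [map_sum ψ, Finset.mul_sum]
  refine Finset.sum_congr rfl fun i _ => ?_
  simp
  ring

-- The contraction defining the star does not depend on the basis, so it can be evaluated in h,
-- where the volume form is ε times the determinant. The sign ε records the orientation of e
-- relative to h.
set_option maxHeartbeats 1000000 in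
theorem hodgeStar_eq (H : IsOrtho g h) (N : IsNormalForm F h α β) (e : Basis (Fin 4) ℝ L) :
    ∃ ε : ℝ, ε ^ 2 = 1 ∧ ∀ x y, g.hodgeStar e F x y =
      ε * (β * planeForm g h 0 1 x y + α * planeForm g h 2 3 x y) := by
  obtain ⟨ε, hε, hv⟩ := H.volumeForm_eq e
  refine ⟨ε, hε, fun x y => ?_⟩
  set X : Fin 4 → Fin 4 → ℝ := fun i j => planeForm g h i j x y with hX
  -- D is the determinant with its last two arguments fixed to x and y, written by Laplace expansion
  -- through the 2×2 minors of x and y.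
  set D := Matrix.toBilin h !![0, X 2 3, -X 1 3, X 1 2; -X 2 3, 0, X 0 3, -X 0 2;
    X 1 3, -X 0 3, 0, X 0 1; -X 1 2, X 0 2, -X 0 1, 0] with hD
  have hdet : ∀ z w, h.det ![z, w, x, y] = D z w := by
    intro z w
    have hm : h.toMatrix ![z, w, x, y] = .transpose (.of ![h.repr z, h.repr w, h.repr x, h.repr y]) := by
      ext i j
      fin_cases j <;> simp [Basis.toMatrix_apply]
    rw [hD, Matrix.toBilin_apply, Basis.det_apply, hm, Matrix.det_transpose]
    simp only [hX, planeForm, ← H.repr_apply]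
    generalize (h.repr x : Fin 4 → ℝ) = x'
    generalize (h.repr y : Fin 4 → ℝ) = y'
    generalize (h.repr z : Fin 4 → ℝ) = z'
    generalize (h.repr w : Fin 4 → ℝ) = w'
    simp [Matrix.det_succ_row_zero, Fin.sum_univ_succ, Fin.succAbove]
    ring
  have h1 : g.hodgeStar e F x y = 1 / 2 * (ε * ∑ i, ∑ j,
      F (g.sharp (e.coord i)) (g.sharp (e.coord j)) * D (e i) (e j)) := by
    simp only [Metric.hodgeStar, hv, AlternatingMap.smul_apply, smul_eq_mul, hdet, Finset.mul_sum]
    refine Finset.sum_congr rfl fun i _ => Finset.sum_congr rfl fun j _ => by ring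
  have h2 : ∑ i, ∑ j, F (g.sharp (e.coord i)) (g.sharp (e.coord j)) * D (e i) (e j) =
      ∑ k, ∑ l, F (h k) (h l) * D (h k) (h l) := by
    simp only [H.sum_sharp e (F _) (D _)]
    rw [Finset.sum_comm]
    conv_rhs => rw [Finset.sum_comm]
    exact Finset.sum_congr rfl fun l _ => H.sum_sharp e (F.flip (h l)) (D.flip (h l))
  rw [h1, h2]
  have h3 : ∀ i j, D (h i) (h j) = !![0, X 2 3, -X 1 3, X 1 2; -X 2 3, 0, X 0 3, -X 0 2;
      X 1 3, -X 0 3, 0, X 0 1; -X 1 2, X 0 2, -X 0 1, 0] i j := by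
    intro i j
    rw [hD, Matrix.toBilin_apply]
    simp [Finsupp.single_apply]
  simp only [h3, N.apply_basis, Fin.sum_univ_four]
  simp [wedge, Matrix.single]
  ring

end IsNormalForm

end EinsteinMaxwell

/-! ### Frames adapted to a solution -/

namespace EinsteinMaxwell

open Module

variable {L : Type*} [LieRing L] [LieAlgebra ℝ L]

theorem exists_basis_of_form {g : Metric L} (hL : finrank ℝ L = 4) (v : Fin 4 → L)
    (hv : ∀ i j, g.form (v i) (v j) = if i = j then 1 else 0) :
    ∃ h : Basis (Fin 4) ℝ L, ⇑h = v ∧ IsOrtho g h := by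
  have hli : LinearIndependent ℝ v := by
    rw [Fintype.linearIndependent_iff]
    intro c hc i
    have := congrArg (fun w => g.form w (v i)) hc
    simpa [hv] using this
  refine ⟨basisOfLinearIndependentOfCardEqFinrank hli (by simp [hL]), by simp, fun i j => ?_⟩
  simp [hv]

variable [FiniteDimensional ℝ L]

/-- The right-hand side is ½(α² − β²) diag(1, 1, −1, −1) in the frame, and the scalar curvature
drops out of differences of diagonal entries. -/
theorem einsteinMaxwell_iff {g : Metric L} {F : LinearMap.BilinForm ℝ L}
    {h : Basis (Fin 4) ℝ L} {α β : ℝ} (H : IsOrtho g h) (N : IsNormalForm F h α β) :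
    g.ricciZero = -g.traceFree (g.compSelf F) ↔
      (∀ i j, i ≠ j → g.ricci (h i) (h j) = 0) ∧ g.ricci (h 0) (h 0) = g.ricci (h 1) (h 1) ∧
      g.ricci (h 2) (h 2) = g.ricci (h 3) (h 3) ∧
      g.ricci (h 0) (h 0) - g.ricci (h 2) (h 2) = α ^ 2 - β ^ 2 := by
  have hz : ∀ i j, g.ricciZero (h i) (h j) = g.ricci (h i) (h j) -
      (g.ricci (h 0) (h 0) + g.ricci (h 1) (h 1) + g.ricci (h 2) (h 2) + g.ricci (h 3) (h 3)) / 4 *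
        if i = j then 1 else 0 := by
    intro i j
    simp only [Metric.ricciZero, Metric.traceFree, H.tr_eq, LinearMap.sub_apply,
      LinearMap.smul_apply, H _ _, Fin.sum_univ_four, smul_eq_mul]
  constructor
  · intro hE
    have key : ∀ i j, g.ricciZero (h i) (h j) = Matrix.diagonal ![(α ^ 2 - β ^ 2) / 2,
        (α ^ 2 - β ^ 2) / 2, (β ^ 2 - α ^ 2) / 2, (β ^ 2 - α ^ 2) / 2] i j := by
      intro i j
      rw [hE, N.neg_traceFree_compSelf H]
    have k0 := key 0 0
    have k1 := key 1 1
    have k2 := key 2 2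
    have k3 := key 3 3
    simp [hz] at k0 k1 k2 k3
    refine ⟨fun i j hij => ?_, ?_, ?_, ?_⟩
    · have := key i j
      simpa [hz, hij] using this
    all_goals linarith
  · rintro ⟨h0, h1, h2, h3⟩
    refine LinearMap.BilinForm.ext_basis h fun i j => ?_
    rw [N.neg_traceFree_compSelf H, hz]
    rcases eq_or_ne i j with rfl | hij
    · fin_cases i <;> simp <;> linarith
    · simp [hij, h0]

/-- An orthonormal frame in which the form of a non-Einstein solution is in normal form. -/
structure IsAdapted (g : Metric L) (F : LinearMap.BilinForm ℝ L) (h : Basis (Fin 4) ℝ L)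
    (α β : ℝ) : Prop where
  ortho : IsOrtho g h
  normal : IsNormalForm F h α β
  closed01 : ClosedForm (planeForm g h 0 1)
  closed23 : ClosedForm (planeForm g h 2 3)
  em : g.ricciZero = -g.traceFree (g.compSelf F)
  ne : α ^ 2 ≠ β ^ 2

/-- If α² = β², then F∘F is a multiple of g and the metric is Einstein. Otherwise dF = 0 and d⋆F = 0
are two equations in dh¹² and dh³⁴ with determinant ε(α² − β²) ≠ 0, so each of these forms is
closed. -/
theorem IsSolution.exists_adapted (hL : finrank ℝ L = 4) {g : Metric L}
    {F : LinearMap.BilinForm ℝ L} {e : Basis (Fin 4) ℝ L} (hs : IsSolution g e F) :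
    ∃ h α β, IsAdapted g F h α β := by
  obtain ⟨h, α, β, H, N⟩ := exists_normalForm hL g F hs.alt
  have hne : α ^ 2 ≠ β ^ 2 := by
    intro hαβ
    refine hs.not_einstein (hs.einstein_maxwell.trans (LinearMap.BilinForm.ext_basis h fun i j => ?_))
    rw [N.neg_traceFree_compSelf H, hαβ]
    fin_cases i <;> fin_cases j <;> simp
  obtain ⟨ε, hε, hstar⟩ := N.hodgeStar_eq H e
  have hε0 : ε ≠ 0 := by
    rintro rfl
    norm_num at hε
  have hcl := hs.closed
  have hco := hs.coclosed
  have h1 := fun x y z => hcl x y z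
  have h2 := fun x y z => hco x y z
  simp only [N.apply_eq H] at h1
  simp only [hstar] at h2
  have hne' : α ^ 2 - β ^ 2 ≠ 0 := sub_ne_zero.mpr hne
  refine ⟨h, α, β, H, N, fun x y z => ?_, fun x y z => ?_, hs.einstein_maxwell, hne⟩
  · apply mul_left_cancel₀ (mul_ne_zero hne' hε0)
    linear_combination α * ε * h1 x y z - β * h2 x y z
  · apply mul_left_cancel₀ (mul_ne_zero hne' hε0)
    linear_combination -β * ε * h1 x y z + α * h2 x y z

theorem IsAdapted.isSolution {g : Metric L} {F : LinearMap.BilinForm ℝ L}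
    {h : Basis (Fin 4) ℝ L} {α β : ℝ} (A : IsAdapted g F h α β) (e : Basis (Fin 4) ℝ L) :
    IsSolution g e F := by
  obtain ⟨ε, hε, hstar⟩ := A.normal.hodgeStar_eq A.ortho e
  refine ⟨A.normal.alt, A.em, fun x y z => ?_, fun x y z => ?_, fun hE => A.ne ?_⟩
  · simp only [A.normal.apply_eq A.ortho]
    linear_combination α * A.closed01 x y z + β * A.closed23 x y z
  · simp only [hstar]
    linear_combination ε * β * A.closed01 x y z + ε * α * A.closed23 x y z
  · have := A.normal.neg_traceFree_compSelf A.ortho 0 0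
    rw [← A.em, show g.ricciZero = 0 from hE] at this
    simp at this
    linarith

namespace IsAdapted

variable {g : Metric L} {F : LinearMap.BilinForm ℝ L} {h : Basis (Fin 4) ℝ L} {α β : ℝ}

/-- This symmetry permits assuming that ⟨h₃, h₄⟩ is the nonabelian plane when exactly one plane is.
-/
theorem swap (A : IsAdapted g F h α β) :
    ∃ h' : Basis (Fin 4) ℝ L, ⇑h' = ![h 2, h 3, h 0, h 1] ∧ IsAdapted g F h' β α := by
  obtain ⟨h', hh, H⟩ := exists_basis_of_form (g := g) (by simp [finrank_eq_card_basis h])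
    ![h 2, h 3, h 0, h 1] (by
      intro i j
      fin_cases i <;> fin_cases j <;> simp [A.ortho _ _])
  have hsk := apply_swap_of_alt A.normal.alt
  refine ⟨h', hh, H, ⟨A.normal.alt, ?_, ?_, ?_, ?_, ?_, ?_⟩, ?_, ?_, A.em, A.ne.symm⟩
  · simp [hh, A.normal.f23]
  · simp [hh, hsk (h 2), A.normal.f02]
  · simp [hh, hsk (h 2), A.normal.f12]
  · simp [hh, hsk (h 3), A.normal.f03]
  · simp [hh, hsk (h 3), A.normal.f13]
  · simp [hh, A.normal.f01]
  · simpa [planeForm, hh, ClosedForm] using A.closed23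
  · simpa [planeForm, hh, ClosedForm] using A.closed01

theorem rotate (A : IsAdapted g F h α β) {c σ : ℝ} (hc : c ^ 2 + σ ^ 2 = 1) :
    ∃ h' : Basis (Fin 4) ℝ L, ⇑h' = ![c • h 0 + σ • h 1, -σ • h 0 + c • h 1, h 2, h 3] ∧
      IsAdapted g F h' α β := by
  obtain ⟨h', hh, H⟩ := exists_basis_of_form (g := g) (by simp [finrank_eq_card_basis h])
    ![c • h 0 + σ • h 1, -σ • h 0 + c • h 1, h 2, h 3] (by
      intro i j
      fin_cases i <;> fin_cases j <;> simp [A.ortho _ _] <;>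
        first | ring1 | linear_combination hc)
  refine ⟨h', hh, H, ⟨A.normal.alt, ?_, ?_, ?_, ?_, ?_, ?_⟩, ?_, ?_, A.em, A.ne⟩
  · simp [hh, A.normal.f01, A.normal.alt, apply_swap_of_alt A.normal.alt (h 1) (h 0)]
    linear_combination α * hc
  · simp [hh, A.normal.f02, A.normal.f12]
  · simp [hh, A.normal.f03, A.normal.f13]
  · simp [hh, A.normal.f02, A.normal.f12]
  · simp [hh, A.normal.f03, A.normal.f13]
  · simp [hh, A.normal.f23]
  · have : planeForm g h' 0 1 = planeForm g h 0 1 := by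
      ext x y
      simp [planeForm, hh]
      linear_combination
        (g.form x (h 0) * g.form y (h 1) - g.form x (h 1) * g.form y (h 0)) * hc
    rw [this]
    exact A.closed01
  · simpa [planeForm, hh, ClosedForm] using A.closed23

/-- The kernel of a closed form is a subalgebra, so h³⁴ and h¹² yield the first two groups. The
remaining components of closedness say that each plane preserves the area form of the other one,
that is, acts on it with zero trace modulo itself. -/
theorem lie_mem (A : IsAdapted g F h α β) :
    (g.form ⁅h 0, h 1⁆ (h 2) = 0 ∧ g.form ⁅h 0, h 1⁆ (h 3) = 0) ∧
    (g.form ⁅h 2, h 3⁆ (h 0) = 0 ∧ g.form ⁅h 2, h 3⁆ (h 1) = 0) ∧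
    (g.form ⁅h 1, h 2⁆ (h 1) = -g.form ⁅h 0, h 2⁆ (h 0) ∧
      g.form ⁅h 1, h 3⁆ (h 1) = -g.form ⁅h 0, h 3⁆ (h 0) ∧
      g.form ⁅h 0, h 3⁆ (h 3) = -g.form ⁅h 0, h 2⁆ (h 2) ∧
      g.form ⁅h 1, h 3⁆ (h 3) = -g.form ⁅h 1, h 2⁆ (h 2)) := by
  have a1 := A.closed01 (h 0) (h 1) (h 2)
  have a2 := A.closed01 (h 0) (h 1) (h 3)
  have a3 := A.closed01 (h 0) (h 2) (h 3)
  have a4 := A.closed01 (h 1) (h 2) (h 3)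
  have b1 := A.closed23 (h 0) (h 1) (h 2)
  have b2 := A.closed23 (h 0) (h 1) (h 3)
  have b3 := A.closed23 (h 0) (h 2) (h 3)
  have b4 := A.closed23 (h 1) (h 2) (h 3)
  have hs : ∀ i j k, g.form ⁅h i, h j⁆ (h k) = -g.form ⁅h j, h i⁆ (h k) := by
    intro i j k
    rw [← lie_skew (h i) (h j), map_neg, LinearMap.neg_apply]
  simp [planeForm, A.ortho _ _] at a1 a2 a3 a4 b1 b2 b3 b4
  refine ⟨⟨?_, ?_⟩, ⟨?_, ?_⟩, ?_, ?_, ?_, ?_⟩ <;>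
    linarith [hs 2 0 0, hs 2 0 2, hs 3 0 0, hs 3 0 3, hs 3 1 1, hs 3 1 3]

theorem exists_frameBrackets (A : IsAdapted g F h α β) (h0 : g.form ⁅h 0, h 1⁆ (h 0) = 0)
    (h2 : g.form ⁅h 2, h 3⁆ (h 2) = 0) :
    HasFrameBrackets h (g.form ⁅h 0, h 1⁆ (h 1)) (g.form ⁅h 2, h 3⁆ (h 3))
      (-g.form ⁅h 0, h 2⁆ (h 0)) (-g.form ⁅h 1, h 2⁆ (h 0)) (-g.form ⁅h 0, h 2⁆ (h 1))
      (-g.form ⁅h 0, h 3⁆ (h 0)) (-g.form ⁅h 1, h 3⁆ (h 0)) (-g.form ⁅h 0, h 3⁆ (h 1))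
      (g.form ⁅h 0, h 2⁆ (h 2)) (g.form ⁅h 0, h 3⁆ (h 2)) (g.form ⁅h 0, h 2⁆ (h 3))
      (g.form ⁅h 1, h 2⁆ (h 2)) (g.form ⁅h 1, h 3⁆ (h 2)) (g.form ⁅h 1, h 2⁆ (h 3)) := by
  obtain ⟨⟨m1, m2⟩, ⟨m3, m4⟩, m5, m6, m7, m8⟩ := A.lie_mem
  refine ⟨?_, ?_, ?_, ?_, ?_, ?_⟩ <;>
    · refine A.ortho.ext fun i => ?_
      fin_cases i <;> simp [A.ortho _ _, *]

end IsAdapted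

end EinsteinMaxwell

/-! ### Two nonabelian planes; alignment and rotation of frames -/

namespace EinsteinMaxwell

theorem eq_zero_of_nonabelian_planes {a b p q r s t u P Q R S T U : ℝ} (ha : a ≠ 0) (hb : b ≠ 0)
    (j : (b * Q = a * s ∧ b * P = a * p ∧ b * T = a * t ∧ b * S = a * q) ∧
      (q * u - r * t = b * s ∧ 2 * (r * s - p * u) = b * u ∧ 2 * (p * t - q * s) = b * t) ∧
      (Q * U - R * T = a * S ∧ 2 * (R * S - P * U) = a * U ∧ 2 * (P * T - Q * S) = a * T) ∧
      (P * q + R * t - S * p - U * s + a * q = 0 ∧ P * p + R * s + S * r + U * u + a * p = 0 ∧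
      P * t - Q * q - S * s + T * p - a * t = 0 ∧ P * s - Q * p + S * u - T * r - a * s = 0))
    (r02 : frameRicci a b p q r s t u P Q R S T U 0 2 = 0)
    (r03 : frameRicci a b p q r s t u P Q R S T U 0 3 = 0)
    (r12 : frameRicci a b p q r s t u P Q R S T U 1 2 = 0) :
    p = 0 ∧ q = 0 ∧ r = 0 ∧ s = 0 ∧ t = 0 ∧ u = 0 ∧
      P = 0 ∧ Q = 0 ∧ R = 0 ∧ S = 0 ∧ T = 0 ∧ U = 0 := by
  obtain ⟨⟨jQ, jP, jT, jS⟩, ⟨i1, i2, i3⟩, ⟨k1, k2, k3⟩, l1, l2, l3, l4⟩ := j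
  simp [frameRicci] at r02 r03 r12
  -- In units of b for the lower-case constants and of a for the upper-case ones, the Jacobi
  -- identities no longer involve a and b, and the first group identifies P, Q, S, T with p, s, q,
  -- t.
  obtain ⟨p, rfl⟩ : ∃ x, p = b * x := ⟨p / b, by field_simp⟩
  obtain ⟨q, rfl⟩ : ∃ x, q = b * x := ⟨q / b, by field_simp⟩
  obtain ⟨r, rfl⟩ : ∃ x, r = b * x := ⟨r / b, by field_simp⟩
  obtain ⟨s, rfl⟩ : ∃ x, s = b * x := ⟨s / b, by field_simp⟩
  obtain ⟨t, rfl⟩ : ∃ x, t = b * x := ⟨t / b, by field_simp⟩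
  obtain ⟨u, rfl⟩ : ∃ x, u = b * x := ⟨u / b, by field_simp⟩
  obtain ⟨R, rfl⟩ : ∃ x, R = a * x := ⟨R / a, by field_simp⟩
  obtain ⟨U, rfl⟩ : ∃ x, U = a * x := ⟨U / a, by field_simp⟩
  obtain rfl : Q = a * s := mul_left_cancel₀ hb (by linear_combination jQ)
  obtain rfl : P = a * p := mul_left_cancel₀ hb (by linear_combination jP)
  obtain rfl : T = a * t := mul_left_cancel₀ hb (by linear_combination jT)
  obtain rfl : S = a * q := mul_left_cancel₀ hb (by linear_combination jS)
  have hab : a * b ≠ 0 := mul_ne_zero ha hb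
  have hbb : b * b ≠ 0 := mul_ne_zero hb hb
  have haa : a * a ≠ 0 := mul_ne_zero ha ha
  replace i1 : q * u - r * t = s := mul_left_cancel₀ hbb (by linear_combination i1)
  replace i2 : 2 * (r * s - p * u) = u := mul_left_cancel₀ hbb (by linear_combination i2)
  replace i3 : 2 * (p * t - q * s) = t := mul_left_cancel₀ hbb (by linear_combination i3)
  replace k1 : s * U - R * t = q := mul_left_cancel₀ haa (by linear_combination k1)
  replace k2 : 2 * (R * q - p * U) = U := mul_left_cancel₀ haa (by linear_combination k2)
  replace l2 : p ^ 2 + p + R * s + q * r + U * u = 0 :=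
    mul_left_cancel₀ hab (by linear_combination l2)
  -- From [A, B] = B follows tr B² = 0, so the traceless matrix B is nilpotent; `hD` is the same
  -- fact for the other plane.
  have hB : s ^ 2 + t * u = 0 := by
    linear_combination -s * i1 - t / 2 * i2 - u / 2 * i3
  have hD : q ^ 2 + t * U = 0 := by
    linear_combination -q * k1 - t / 2 * k2 - U / 2 * i3
  have ht : t = 0 := by
    -- Multiplied by t², `l2` contains only the products rt, Rt, tu, tU and pt besides q, s, t.
    -- Substituting them from `i1`, `k1`, `hB`, `hD` and `i3` leaves ¾t².
    have : 3 / 4 * t ^ 2 = 0 := by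
      grind
    simpa using this
  subst ht
  obtain rfl : s = 0 := by simpa using hB
  obtain rfl : q = 0 := by simpa using hD
  -- Eliminating Uu between the Jacobi identity `l2` and Ric(h₁, h₃) = 0 leaves p = 0 or p = 7. In
  -- the second case `i2` gives u = 0, and `l2` becomes 49 + 7 = 0.
  have h7 : p * (p - 7) = 0 :=
    mul_left_cancel₀ hab (by linear_combination -a * b * l2 - 2 * r02)
  have hp : p = 0 := by
    rcases mul_eq_zero.mp h7 with h | h
    · exact h
    · obtain rfl : p = 7 := by linarith
      have hu : u = 0 := by linarith
      subst hu
      norm_num at l2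
  subst hp
  have hu : u = 0 := by linarith
  have hU : U = 0 := by linarith
  subst hu hU
  have hR : R = 0 := by
    apply mul_left_cancel₀ hab
    linear_combination r03
  have hr : r = 0 := by
    apply mul_left_cancel₀ hab
    linear_combination r12
  subst hR hr
  simp

theorem exists_unit_orthogonal (x y : ℝ) : ∃ c σ : ℝ, c ^ 2 + σ ^ 2 = 1 ∧ c * x + σ * y = 0 := by
  by_cases h : x ^ 2 + y ^ 2 = 0
  · refine ⟨1, 0, by norm_num, ?_⟩
    have : x = 0 := by nlinarith [sq_nonneg x, sq_nonneg y]
    simp [this]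
  · have hpos : 0 < x ^ 2 + y ^ 2 := lt_of_le_of_ne (by positivity) (Ne.symm h)
    have hs := Real.sq_sqrt hpos.le
    have hne : √(x ^ 2 + y ^ 2) ≠ 0 := (Real.sqrt_pos.mpr hpos).ne'
    refine ⟨y / √(x ^ 2 + y ^ 2), -x / √(x ^ 2 + y ^ 2), ?_, ?_⟩
    · rw [div_pow, div_pow, hs]
      field_simp
      ring
    · field_simp
      ring

/-- Two parallel vectors are annihilated by the same unit covector. -/
theorem exists_unit_of_parallel {x y : Fin 3 → ℝ} (h : ∀ i j, x i * y j = x j * y i) :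
    ∃ c σ : ℝ, c ^ 2 + σ ^ 2 = 1 ∧ ∀ i, c * x i + σ * y i = 0 := by
  by_cases h0 : ∀ i, x i = 0 ∧ y i = 0
  · exact ⟨1, 0, by norm_num, fun i => by simp [h0 i]⟩
  · push Not at h0
    obtain ⟨k, hk⟩ := h0
    obtain ⟨c, σ, h1, h2⟩ := exists_unit_orthogonal (x k) (y k)
    refine ⟨c, σ, h1, fun i => ?_⟩
    by_cases hx : x k = 0
    · have hy := hk hx
      have hσ : σ = 0 := by simpa [hx, hy] using h2
      have hxi : x i = 0 := by simpa [hx, hy] using h i k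
      simp [hσ, hxi]
    · apply mul_left_cancel₀ hx
      linear_combination x i * h2 + σ * h k i

open Module

variable {L : Type*} [LieRing L] [LieAlgebra ℝ L] {g : Metric L}
  {F : LinearMap.BilinForm ℝ L} {h : Basis (Fin 4) ℝ L} {α β : ℝ}
  {a b p q r s t u P Q R S T U : ℝ}

theorem HasFrameBrackets.swap {h' : Basis (Fin 4) ℝ L} (hh : ⇑h' = ![h 2, h 3, h 0, h 1])
    (hb : HasFrameBrackets h a b p q r s t u P Q R S T U) :
    HasFrameBrackets h' b a P Q R S T U p q r s t u := by
  obtain ⟨h01, h02, h03, h12, h13, h23⟩ := hb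
  refine ⟨?_, ?_, ?_, ?_, ?_, ?_⟩
  · simpa [hh] using h23
  · simp [hh]
    rw [← lie_skew, h02]
    module
  · simp [hh]
    rw [← lie_skew, h12]
    module
  · simp [hh]
    rw [← lie_skew, h03]
    module
  · simp [hh]
    rw [← lie_skew, h13]
    module
  · simpa [hh] using h01

variable [FiniteDimensional ℝ L]

namespace IsAdapted

/-- A rotation in a plane does not change the bracket of its two frame vectors, so it can be chosen
to make the second vector parallel to that bracket. -/
theorem exists_aligned (A : IsAdapted g F h α β) : ∃ h' : Basis (Fin 4) ℝ L, IsAdapted g F h' α β ∧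
    ∃ a b p q r s t u P Q R S T U, HasFrameBrackets h' a b p q r s t u P Q R S T U := by
  -- One step aligns the first plane and exchanges the planes; two steps align both and restore the
  -- order of α and β.
  have key : ∀ {h : Basis (Fin 4) ℝ L} {α β : ℝ}, IsAdapted g F h α β →
      ∃ h' : Basis (Fin 4) ℝ L, IsAdapted g F h' β α ∧ g.form ⁅h' 2, h' 3⁆ (h' 2) = 0 ∧
      (g.form ⁅h 2, h 3⁆ (h 2) = 0 → g.form ⁅h' 0, h' 1⁆ (h' 0) = 0) := by
    intro h α β A
    obtain ⟨c, σ, hc, h0⟩ := exists_unit_orthogonal (g.form ⁅h 0, h 1⁆ (h 0))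
      (g.form ⁅h 0, h 1⁆ (h 1))
    obtain ⟨h1, hh1, A1⟩ := A.rotate hc
    obtain ⟨h2, hh2, A2⟩ := A1.swap
    refine ⟨h2, A2, ?_, ?_⟩
    · have hs : ⁅h 1, h 0⁆ = -⁅h 0, h 1⁆ := (lie_skew _ _).symm
      simp [hh2, hh1, hs, -lie_skew]
      linear_combination (c ^ 2 + σ ^ 2) * h0
    · simp [hh2, hh1]
  obtain ⟨h1, A1, e1, -⟩ := key A
  obtain ⟨h2, A2, e2, e3⟩ := key A1
  exact ⟨h2, A2, _, _, _, _, _, _, _, _, _, _, _, _, _, _, A2.exists_frameBrackets (e3 e1) e2⟩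

/-- Rotation of the plane of `h₁` and `h₂` when these commute. -/
theorem exists_rotated (A : IsAdapted g F h α β)
    (hb : HasFrameBrackets h 0 b p q r s t u P Q R S T U) {c σ : ℝ} (hc : c ^ 2 + σ ^ 2 = 1) :
    ∃ (h' : Basis (Fin 4) ℝ L) (p' q' r' s' t' u' P' Q' R' S' T' U' : ℝ), IsAdapted g F h' α β ∧
      HasFrameBrackets h' 0 b p' q' r' s' t' u' P' Q' R' S' T' U' ∧
      s' = c * (c * s + σ * t) + σ * (c * u - σ * s) ∧
      t' = c * (-σ * s + c * t) + σ * (-σ * u - c * s) ∧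
      u' = -σ * (c * s + σ * t) + c * (c * u - σ * s) ∧
      S' = -σ * P + c * S ∧ T' = -σ * Q + c * T ∧ U' = -σ * R + c * U := by
  obtain ⟨h', hh, A'⟩ := A.rotate hc
  obtain ⟨h01, h02, h03, h12, h13, h23⟩ := hb
  have h10 : ⁅h 1, h 0⁆ = 0 := by rw [← lie_skew, h01]; simp
  have e01 : ⁅h' 0, h' 1⁆ = 0 := by simp [hh, h01, h10]
  have e23 : ⁅h' 2, h' 3⁆ = b • h' 3 := by simp [hh, h23]
  have hb' := A'.exists_frameBrackets (by simp [e01]) (by simp [e23, A'.ortho _ _])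
  have ea : g.form ⁅h' 0, h' 1⁆ (h' 1) = 0 := by simp [e01]
  have eb : g.form ⁅h' 2, h' 3⁆ (h' 3) = b := by simp [e23, A'.ortho _ _]
  rw [ea, eb] at hb'
  refine ⟨h', _, _, _, _, _, _, _, _, _, _, _, _, A', hb', ?_, ?_, ?_, ?_, ?_, ?_⟩ <;>
    simp [hh, h02, h03, h12, h13, A.ortho _ _] <;> ring

theorem ricci_frame_conditions (A : IsAdapted g F h α β)
    (hb : HasFrameBrackets h a b p q r s t u P Q R S T U) :
    (∀ i j, i ≠ j → frameRicci a b p q r s t u P Q R S T U i j = 0) ∧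
      frameRicci a b p q r s t u P Q R S T U 0 0 = frameRicci a b p q r s t u P Q R S T U 1 1 ∧
      frameRicci a b p q r s t u P Q R S T U 2 2 = frameRicci a b p q r s t u P Q R S T U 3 3 ∧
      frameRicci a b p q r s t u P Q R S T U 0 0 - frameRicci a b p q r s t u P Q R S T U 2 2 =
        α ^ 2 - β ^ 2 := by
  simpa only [hb.ricci_eq A.ortho] using (einsteinMaxwell_iff A.ortho A.normal).mp A.em

end IsAdapted

end EinsteinMaxwell

/-! ### Classification of adapted frames -/

namespace EinsteinMaxwell

open Module

variable {L : Type*} [LieRing L] [LieAlgebra ℝ L] [FiniteDimensional ℝ L] {g : Metric L}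
  {F : LinearMap.BilinForm ℝ L} {h : Basis (Fin 4) ℝ L} {α β : ℝ}
  {a b p q r s t u P Q R S T U : ℝ}

/-- The Lie algebra is a product of two nonabelian planes. -/
def IsProductFrame (h : Basis (Fin 4) ℝ L) (a b : ℝ) : Prop :=
  HasFrameBrackets h a b 0 0 0 0 0 0 0 0 0 0 0 0

/-- `h₃` acts on the abelian ideal of `h₁` and `h₂` by rotations, and on `h₄` by dilations. -/
def IsRotationFrame (h : Basis (Fin 4) ℝ L) (b r : ℝ) : Prop :=
  HasFrameBrackets h 0 b 0 (-r) r 0 0 0 0 0 0 0 0 0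

/-- `h₁`, `h₂` and `h₄` span a Heisenberg algebra, on which `h₃` acts diagonally. -/
def IsHeisenbergFrame (h : Basis (Fin 4) ℝ L) (b t : ℝ) : Prop :=
  HasFrameBrackets h 0 b (b / 2) 0 0 0 t 0 0 0 0 0 0 0

namespace IsAdapted

/-- Each abelian plane acts by commuting traceless 2×2 matrices, which are proportional, so a
rotation makes its second vector act trivially: s = t = u = S = T = U = 0. A nonzero P contradicts
Ric(h₁, h₁) = Ric(h₂, h₂) and a nonzero p contradicts Ric(h₃, h₃) = Ric(h₄, h₄), by sums of squares.
The remaining cases give α² = β². -/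
theorem false_of_abelian_planes (A : IsAdapted g F h α β)
    (hb : HasFrameBrackets h 0 0 p q r s t u P Q R S T U) : False := by
  obtain ⟨-, -, ⟨i1, i2, i3⟩, -⟩ := hb.jacobi A.ortho
  obtain ⟨c, σ, hc, h0⟩ := exists_unit_of_parallel (x := ![P, Q, R]) (y := ![S, T, U]) (by
    intro i j
    fin_cases i <;> fin_cases j <;> simp <;> linarith)
  have h0' := h0 0
  have h1' := h0 1
  have h2' := h0 2
  simp at h0' h1' h2'
  obtain ⟨h1, p1, q1, r1, s1, t1, u1, P1, Q1, R1, S1, T1, U1, A1, hb1, -, -, -, hS, hT, hU⟩ :=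
    A.exists_rotated hb (c := σ) (σ := -c) (by linarith)
  obtain rfl : S1 = 0 := by linear_combination hS + h0'
  obtain rfl : T1 = 0 := by linear_combination hT + h1'
  obtain rfl : U1 = 0 := by linear_combination hU + h2'
  obtain ⟨h2, hh2, A2⟩ := A1.swap
  have hb2 := hb1.swap hh2
  obtain ⟨-, -, ⟨i1, i2, i3⟩, -⟩ := hb2.jacobi A2.ortho
  obtain ⟨c, σ, hc, h0⟩ := exists_unit_of_parallel (x := ![p1, q1, r1]) (y := ![s1, t1, u1]) (by
    intro i j
    fin_cases i <;> fin_cases j <;> simp <;> linarith)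
  have h0' := h0 0
  have h1' := h0 1
  have h2' := h0 2
  simp at h0' h1' h2'
  obtain ⟨h3, p, q, r, s, t, u, P, Q, R, S, T, U, A3, hb3, hs, ht, hu, hS, hT, hU⟩ :=
    A2.exists_rotated hb2 (c := σ) (σ := -c) (by linarith)
  obtain rfl : S = 0 := by linear_combination hS + h0'
  obtain rfl : T = 0 := by linear_combination hT + h1'
  obtain rfl : U = 0 := by linear_combination hU + h2'
  obtain rfl : s = 0 := by simpa using hs
  obtain rfl : t = 0 := by simpa using ht
  obtain rfl : u = 0 := by simpa using hu
  obtain ⟨-, -, -, j1, j2, j3, j4⟩ := hb3.jacobi A3.ortho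
  obtain ⟨ho, r1, r2, r3⟩ := A3.ricci_frame_conditions hb3
  have o03 := ho 0 3 (by decide)
  have o12 := ho 1 2 (by decide)
  have o13 := ho 1 3 (by decide)
  simp [frameRicci] at o03 o12 o13 r1 r2 r3 j1 j2 j3 j4
  have hne := A3.ne
  have hP : P = 0 := by
    by_contra hP
    simp [hP] at j1 j2 o12
    subst j1 j2
    simp [hP] at o12
    subst o12
    nlinarith [sq_nonneg (Q + R), sq_pos_of_ne_zero hP]
  subst hP
  have hp : p = 0 := by
    by_contra hp
    simp [hp] at j4 o03
    simp [j4] at o03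
    subst j4
    obtain rfl | rfl := o03
    · nlinarith [sq_nonneg (q + r), sq_pos_of_ne_zero hp]
    · exact hp rfl
  subst hp
  replace o13 : R = 0 ∨ r = 0 := by rcases j3 with rfl | rfl <;> simpa using o13
  apply hne
  rcases j3 with rfl | rfl <;> rcases o13 with rfl | rfl <;>
    linarith [sq_nonneg q, sq_nonneg r, sq_nonneg Q, sq_nonneg R]

/-- A rotation achieves U = 0, and b ≠ 0 kills P, Q, S, T by Jacobi. Once R is excluded, Ric(h₃, h₃)
= Ric(h₄, h₄) reads 2p² + ½(q + r)² = 0, so the action of h₃ is skew. -/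
theorem exists_rotationFrame (A : IsAdapted g F h α β) (hb0 : b ≠ 0)
    (hb : HasFrameBrackets h 0 b p q r 0 0 0 P Q R S T U) :
    ∃ (h' : Basis (Fin 4) ℝ L) (r' : ℝ), IsAdapted g F h' α β ∧ IsRotationFrame h' b r' := by
  obtain ⟨c, σ, hc, h0⟩ := exists_unit_orthogonal (-U) R
  obtain ⟨h', p, q, r, s, t, u, P, Q, R, S, T, U, A', hb', hs, ht, hu, -, -, hU⟩ :=
    A.exists_rotated hb hc
  obtain rfl : s = 0 := by simpa using hs
  obtain rfl : t = 0 := by simpa using ht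
  obtain rfl : u = 0 := by simpa using hu
  obtain rfl : U = 0 := by linear_combination hU - h0
  obtain ⟨⟨jQ, jP, jT, jS⟩, -, -, -⟩ := hb'.jacobi A'.ortho
  simp [hb0] at jQ jP jT jS
  subst jQ jP jT jS
  obtain ⟨ho, r1, r2, r3⟩ := A'.ricci_frame_conditions hb'
  have o01 := ho 0 1 (by decide)
  have o03 := ho 0 3 (by decide)
  have o13 := ho 1 3 (by decide)
  simp [frameRicci] at o01 o03 o13 r1 r2 r3
  have hR : R = 0 := by
    by_contra hR
    simp [hR] at o13
    subst o13
    have hp : p = 2 * b := mul_left_cancel₀ hR (by linarith)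
    subst hp
    have hq : q = 0 := mul_left_cancel₀ hb0 (by linarith)
    subst hq
    nlinarith [sq_pos_of_ne_zero hb0, sq_nonneg R]
  subst hR
  have hp : p = 0 := by nlinarith [sq_nonneg p, sq_nonneg (q + r)]
  have hq : q = -r := by
    have : (q + r) ^ 2 = 0 := by nlinarith [sq_nonneg p, sq_nonneg (q + r)]
    have := pow_eq_zero_iff (two_ne_zero) |>.mp this
    linarith
  subst hp hq
  exact ⟨h', r, A', hb'⟩

/-- The action B of h₄ is nonzero and nilpotent since [A, B] = bB, hence strictly triangular after a
rotation. The same relation then gives p = b/2 and r = 0; the Ricci conditions give q = U = 0 and t²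
= b². -/
theorem exists_heisenbergFrame (A : IsAdapted g F h α β) (hb0 : b ≠ 0)
    (hb : HasFrameBrackets h 0 b p q r s t u P Q R S T U) (h0 : ¬(s = 0 ∧ t = 0 ∧ u = 0)) :
    ∃ (h' : Basis (Fin 4) ℝ L) (t' : ℝ), IsAdapted g F h' α β ∧ t' ^ 2 = b ^ 2 ∧
      IsHeisenbergFrame h' b t' := by
  obtain ⟨-, ⟨i1, i2, i3⟩, -, -⟩ := hb.jacobi A.ortho
  have hB : s ^ 2 + t * u = 0 := by
    apply mul_left_cancel₀ hb0
    linear_combination -s * i1 - t / 2 * i2 - u / 2 * i3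
  -- The unit vector (c, σ) spans the kernel of the nilpotent matrix (s t; u −s) and becomes the new
  -- h₁.
  obtain ⟨c, σ, hc, hst, hus⟩ : ∃ c σ : ℝ, c ^ 2 + σ ^ 2 = 1 ∧ c * s + σ * t = 0 ∧
      c * u - σ * s = 0 := by
    by_cases ht : t = 0
    · obtain rfl : s = 0 := by simpa [ht] using hB
      exact ⟨0, 1, by norm_num, by simp [ht], by simp⟩
    · obtain ⟨c, σ, hc, hst⟩ := exists_unit_orthogonal s t
      refine ⟨c, σ, hc, hst, mul_left_cancel₀ ht ?_⟩
      linear_combination c * hB - s * hst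
  obtain ⟨h', p', q', r', s', t', u', P, Q, R, S, T, U, A', hb', hs, ht, hu, -, -, -⟩ :=
    A.exists_rotated hb hc
  obtain rfl : s' = 0 := by simpa [hst, hus] using hs
  obtain rfl : u' = 0 := by simpa [hst, hus] using hu
  have ht0 : t' ≠ 0 := by
    rintro rfl
    apply h0
    have hs' : s = 0 := by grind
    subst hs'
    grind
  obtain ⟨⟨jQ, jP, jT, jS⟩, ⟨i1, i2, i3⟩, -, ⟨j1, -⟩⟩ := hb'.jacobi A'.ortho
  simp [hb0] at jQ jP jT jS
  subst jQ jP jT jS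
  simp [ht0] at i1 j1
  subst i1 j1
  have hp : p' = b / 2 := mul_left_cancel₀ ht0 (by linarith)
  subst hp
  obtain ⟨ho, r1, r2, r3⟩ := A'.ricci_frame_conditions hb'
  have o23 := ho 2 3 (by decide)
  have o13 := ho 1 3 (by decide)
  simp [frameRicci] at o23 o13 r1 r2 r3
  have hq : q' = 0 := by grind
  subst hq
  have hU : U = 0 := mul_left_cancel₀ hb0 (by linarith)
  subst hU
  exact ⟨h', t', A', by linarith, hb'⟩

/-- The classification of the non-Einstein solutions by orthonormal frames. -/
theorem classification (A : IsAdapted g F h α β) :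
    ∃ (h' : Basis (Fin 4) ℝ L) (α' β' : ℝ), IsAdapted g F h' α' β' ∧
      ((∃ a b, a ≠ 0 ∧ b ≠ 0 ∧ IsProductFrame h' a b) ∨
        (∃ b r, b ≠ 0 ∧ IsRotationFrame h' b r) ∨
        ∃ b t, b ≠ 0 ∧ t ^ 2 = b ^ 2 ∧ IsHeisenbergFrame h' b t) := by
  have key : ∀ {h : Basis (Fin 4) ℝ L} {α β b p q r s t u P Q R S T U : ℝ}, IsAdapted g F h α β →
      b ≠ 0 → HasFrameBrackets h 0 b p q r s t u P Q R S T U →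
      ∃ (h' : Basis (Fin 4) ℝ L) (α' β' : ℝ), IsAdapted g F h' α' β' ∧
      ((∃ a b, a ≠ 0 ∧ b ≠ 0 ∧ IsProductFrame h' a b) ∨
        (∃ b r, b ≠ 0 ∧ IsRotationFrame h' b r) ∨
        ∃ b t, b ≠ 0 ∧ t ^ 2 = b ^ 2 ∧ IsHeisenbergFrame h' b t) := by
    intro h α β b p q r s t u P Q R S T U A hb0 hb
    by_cases h0 : s = 0 ∧ t = 0 ∧ u = 0
    · obtain ⟨rfl, rfl, rfl⟩ := h0
      obtain ⟨h', r', A', hr⟩ := A.exists_rotationFrame hb0 hb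
      exact ⟨h', α, β, A', .inr (.inl ⟨b, r', hb0, hr⟩)⟩
    · obtain ⟨h', t', A', ht, hr⟩ := A.exists_heisenbergFrame hb0 hb h0
      exact ⟨h', α, β, A', .inr (.inr ⟨b, t', hb0, ht, hr⟩)⟩
  obtain ⟨h, A, a, b, p, q, r, s, t, u, P, Q, R, S, T, U, hb⟩ := A.exists_aligned
  by_cases ha0 : a = 0
  · subst ha0
    by_cases hb0 : b = 0
    · subst hb0
      exact (A.false_of_abelian_planes hb).elim
    · exact key A hb0 hb
  · by_cases hb0 : b = 0
    · subst hb0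
      obtain ⟨h', hh, A'⟩ := A.swap
      exact key A' ha0 (hb.swap hh)
    · have ho := (A.ricci_frame_conditions hb).1
      obtain ⟨rfl, rfl, rfl, rfl, rfl, rfl, rfl, rfl, rfl, rfl, rfl, rfl⟩ :=
        eq_zero_of_nonabelian_planes ha0 hb0 (hb.jacobi A.ortho) (ho 0 2 (by decide))
          (ho 0 3 (by decide)) (ho 1 2 (by decide))
      exact ⟨h, α, β, A, .inl ⟨a, b, ha0, hb0, hb⟩⟩

end IsAdapted

end EinsteinMaxwell

/-! ### The three kinds of frames as solutions -/

namespace EinsteinMaxwell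

open Module

variable {L : Type*} [LieRing L] [LieAlgebra ℝ L] {g : Metric L}
  {F : LinearMap.BilinForm ℝ L} {h : Basis (Fin 4) ℝ L} {α β : ℝ}
  {a b p q r s t u P Q R S T U : ℝ}

theorem IsOrtho.form_lie_eq (H : IsOrtho g h) (c : Fin 4 → Fin 4 → Fin 4 → ℝ)
    (hc : ∀ i j k, g.form ⁅h i, h j⁆ (h k) = c i j k) (x y : L) (k : Fin 4) :
    g.form ⁅x, y⁆ (h k) = ∑ i, ∑ j, g.form x (h i) * g.form y (h j) * c i j k := by
  conv_lhs => rw [← H.sum_form x, ← H.sum_form y]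
  simp [lie_sum, sum_lie, hc, mul_assoc, mul_left_comm, Finset.mul_sum]
  exact Finset.sum_comm

theorem HasFrameBrackets.closed01 (H : IsOrtho g h)
    (hb : HasFrameBrackets h a b p q r s t u P Q R S T U) : ClosedForm (planeForm g h 0 1) := by
  intro x y z
  simp only [planeForm, H.form_lie_eq _ (hb.form_lie H)]
  simp [Fin.sum_univ_four, frameConst]
  ring

theorem HasFrameBrackets.closed23 (H : IsOrtho g h)
    (hb : HasFrameBrackets h a b p q r s t u P Q R S T U) : ClosedForm (planeForm g h 2 3) := by
  intro x y z
  simp only [planeForm, H.form_lie_eq _ (hb.form_lie H)]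
  simp [Fin.sum_univ_four, frameConst]
  ring

variable [FiniteDimensional ℝ L]

theorem HasFrameBrackets.isAdapted (H : IsOrtho g h) (N : IsNormalForm F h α β)
    (hb : HasFrameBrackets h a b p q r s t u P Q R S T U)
    (h0 : ∀ i j, i ≠ j → frameRicci a b p q r s t u P Q R S T U i j = 0)
    (h1 : frameRicci a b p q r s t u P Q R S T U 0 0 = frameRicci a b p q r s t u P Q R S T U 1 1)
    (h2 : frameRicci a b p q r s t u P Q R S T U 2 2 = frameRicci a b p q r s t u P Q R S T U 3 3)
    (h3 : frameRicci a b p q r s t u P Q R S T U 0 0 - frameRicci a b p q r s t u P Q R S T U 2 2 =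
      α ^ 2 - β ^ 2) (hne : α ^ 2 ≠ β ^ 2) : IsAdapted g F h α β := by
  refine ⟨H, N, hb.closed01 H, hb.closed23 H, (einsteinMaxwell_iff H N).mpr ?_, hne⟩
  simpa only [hb.ricci_eq H] using ⟨h0, h1, h2, h3⟩

/-- Here Ric = diag(−a², −a², −b², −b²). -/
theorem IsProductFrame.isAdapted (H : IsOrtho g h) (N : IsNormalForm F h α β)
    (hb : IsProductFrame h a b) (h1 : b ^ 2 - a ^ 2 = α ^ 2 - β ^ 2) (h2 : a ^ 2 ≠ b ^ 2) :
    IsAdapted g F h α β := by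
  refine HasFrameBrackets.isAdapted H N hb (fun i j hij => ?_) ?_ ?_ ?_ fun h => h2 (by linarith)
  · fin_cases i <;> fin_cases j <;> simp [frameRicci] at hij ⊢
  all_goals simp [frameRicci]
  linarith

/-- Here Ric = diag(0, 0, −b², −b²), independently of r. -/
theorem IsRotationFrame.isAdapted (H : IsOrtho g h) (N : IsNormalForm F h α β)
    (hb : IsRotationFrame h b r) (h1 : α ^ 2 - β ^ 2 = b ^ 2) (h2 : b ≠ 0) :
    IsAdapted g F h α β := by
  have hb2 : 0 < b ^ 2 := by positivity
  refine HasFrameBrackets.isAdapted H N hb (fun i j hij => ?_) ?_ ?_ ?_ fun h => by linarith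
  · fin_cases i <;> fin_cases j <;> simp [frameRicci] at hij ⊢
  all_goals simp [frameRicci]
  all_goals linarith

/-- With t² = b², Ric = diag(0, 0, −3b²/2, −3b²/2). -/
theorem IsHeisenbergFrame.isAdapted (H : IsOrtho g h) (N : IsNormalForm F h α β)
    (hb : IsHeisenbergFrame h b t) (ht : t ^ 2 = b ^ 2) (h1 : α ^ 2 - β ^ 2 = 3 / 2 * b ^ 2)
    (h2 : b ≠ 0) : IsAdapted g F h α β := by
  have hb2 : 0 < b ^ 2 := by positivity
  refine HasFrameBrackets.isAdapted H N hb (fun i j hij => ?_) ?_ ?_ ?_ fun h => by linarith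
  · fin_cases i <;> fin_cases j <;> simp [frameRicci] at hij ⊢
  all_goals simp [frameRicci]
  all_goals linarith

namespace IsAdapted

theorem product_eq (A : IsAdapted g F h α β) (hb : IsProductFrame h a b) :
    b ^ 2 - a ^ 2 = α ^ 2 - β ^ 2 := by
  have := (A.ricci_frame_conditions hb).2.2.2
  simp [frameRicci] at this
  linarith

theorem rotation_eq (A : IsAdapted g F h α β) (hb : IsRotationFrame h b r) :
    α ^ 2 - β ^ 2 = b ^ 2 := by
  have := (A.ricci_frame_conditions hb).2.2.2
  simp [frameRicci] at this
  linarith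

theorem heisenberg_eq (A : IsAdapted g F h α β) (hb : IsHeisenbergFrame h b t)
    (ht : t ^ 2 = b ^ 2) : α ^ 2 - β ^ 2 = 3 / 2 * b ^ 2 := by
  have := (A.ricci_frame_conditions hb).2.2.2
  simp [frameRicci] at this
  linarith

end IsAdapted

/-! ### Structure constants and isomorphisms -/

/-- The structure constants with given brackets of the basis vectors. -/
def lieConst (x₀₁ x₀₂ x₀₃ x₁₂ x₁₃ x₂₃ : Fin 4 → ℝ) : Fin 4 → Fin 4 → Fin 4 → ℝ :=
  ![![0, x₀₁, x₀₂, x₀₃], ![-x₀₁, 0, x₁₂, x₁₃], ![-x₀₂, -x₁₂, 0, x₂₃], ![-x₀₃, -x₁₃, -x₂₃, 0]]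

omit [FiniteDimensional ℝ L]

theorem HasBrackets.lie_eq {e : Basis (Fin 4) ℝ L} {x₀₁ x₀₂ x₀₃ x₁₂ x₁₃ x₂₃ : Fin 4 → ℝ}
    (he : HasBrackets e (∑ k, x₀₁ k • e k) (∑ k, x₀₂ k • e k) (∑ k, x₀₃ k • e k)
      (∑ k, x₁₂ k • e k) (∑ k, x₁₃ k • e k) (∑ k, x₂₃ k • e k)) (i j : Fin 4) :
    ⁅e i, e j⁆ = ∑ k, lieConst x₀₁ x₀₂ x₀₃ x₁₂ x₁₃ x₂₃ i j k • e k := by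
  obtain ⟨h01, h02, h03, h12, h13, h23⟩ := he
  have h10 := (lie_skew (e 1) (e 0)).symm
  have h20 := (lie_skew (e 2) (e 0)).symm
  have h30 := (lie_skew (e 3) (e 0)).symm
  have h21 := (lie_skew (e 2) (e 1)).symm
  have h31 := (lie_skew (e 3) (e 1)).symm
  have h32 := (lie_skew (e 3) (e 2)).symm
  rw [h01] at h10
  rw [h02] at h20
  rw [h03] at h30
  rw [h12] at h21
  rw [h13] at h31
  rw [h23] at h32
  fin_cases i <;> fin_cases j <;>
    simp only [Fin.reduceFinMk, Fin.zero_eta, Fin.mk_one, Fin.isValue, lie_self, h01, h02, h03, h12,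
      h13, h23, h10, h20, h30, h21, h31, h32] <;>
    simp [lieConst]

theorem exists_lieEquiv {e f : Basis (Fin 4) ℝ L} {c : Fin 4 → Fin 4 → Fin 4 → ℝ}
    (he : ∀ i j, ⁅e i, e j⁆ = ∑ k, c i j k • e k) (hf : ∀ i j, ⁅f i, f j⁆ = ∑ k, c i j k • f k) :
    ∃ φ : L ≃ₗ⁅ℝ⁆ L, ∀ i, φ (e i) = f i := by
  set ψ : L ≃ₗ[ℝ] L := e.equiv f (Equiv.refl _) with hψ
  have hψe : ∀ i, ψ (e i) = f i := fun i => by simp [hψ]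
  have hlie : ∀ x y, ψ ⁅x, y⁆ = ⁅ψ x, ψ y⁆ := by
    intro x y
    conv_lhs => rw [← e.sum_repr x, ← e.sum_repr y]
    conv_rhs => rw [← e.sum_repr x, ← e.sum_repr y]
    simp only [sum_lie, lie_sum, smul_lie, lie_smul, map_sum, map_smul, he, hψe, hf]
  exact ⟨{ ψ with map_lie' := fun {x y} => hlie x y }, hψe⟩

theorem trace_ad {e : Basis (Fin 4) ℝ L} {c : Fin 4 → Fin 4 → Fin 4 → ℝ}
    (he : ∀ i j, ⁅e i, e j⁆ = ∑ k, c i j k • e k) (x : L) :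
    LinearMap.trace ℝ L (LieAlgebra.ad ℝ L x) = ∑ i, e.repr x i * ∑ k, c i k k := by
  conv_lhs => rw [← e.sum_repr x]
  rw [map_sum, map_sum]
  refine Finset.sum_congr rfl fun i _ => ?_
  rw [map_smul, map_smul, smul_eq_mul, LinearMap.trace_eq_matrix_trace ℝ e, Matrix.trace]
  simp [LinearMap.toMatrix_apply, he, Finsupp.single_apply]

theorem trace_ad_ad {e : Basis (Fin 4) ℝ L} {c : Fin 4 → Fin 4 → Fin 4 → ℝ}
    (he : ∀ i j, ⁅e i, e j⁆ = ∑ k, c i j k • e k) (x : L) :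
    LinearMap.trace ℝ L (LieAlgebra.ad ℝ L x ∘ₗ LieAlgebra.ad ℝ L x) =
      ∑ i, ∑ j, e.repr x i * e.repr x j * ∑ k, ∑ l, c i l k * c j k l := by
  have hx : ∀ k, ⁅x, e k⁆ = ∑ i, e.repr x i • ⁅e i, e k⁆ := by
    intro k
    conv_lhs => rw [← e.sum_repr x, sum_lie]
    simp only [smul_lie]
  have hr : ∀ k l, e.repr ⁅x, e k⁆ l = ∑ i, e.repr x i * c i k l := by
    intro k l
    simp [hx, he, Finsupp.single_apply]
  rw [LinearMap.trace_eq_matrix_trace ℝ e, LinearMap.toMatrix_comp e e e, Matrix.trace]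
  simp only [Matrix.diag_apply, Matrix.mul_apply, LinearMap.toMatrix_apply, LieAlgebra.ad_apply, hr,
    Finset.sum_mul_sum]
  simp only [Fin.sum_univ_four]
  ring

end EinsteinMaxwell

/-! ### The Killing ratio, and standard bases obtained from frames -/

namespace EinsteinMaxwell

open Module

variable {L : Type*} [LieRing L] [LieAlgebra ℝ L] {g : Metric L}
  {F : LinearMap.BilinForm ℝ L} {h e : Basis (Fin 4) ℝ L} {α β a b r t : ℝ}

theorem exists_scaled_basis (h : Basis (Fin 4) ℝ L) (s : Fin 4 → Fin 4)
    (hs : Function.Injective s) (d : Fin 4 → ℝ) (hd : ∀ i, d i ≠ 0) :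
    ∃ f : Basis (Fin 4) ℝ L, ∀ i, f i = d i • h (s i) := by
  refine ⟨(h.reindex (Equiv.ofBijective s (Finite.injective_iff_bijective.mp hs)).symm).isUnitSMul
    fun i => (hd i).isUnit, fun i => ?_⟩
  simp [Basis.isUnitSMul_apply]

theorem IsTwoA2.lie_eq (he : IsTwoA2 e) (i j : Fin 4) :
    ⁅e i, e j⁆ = ∑ k, lieConst ![0, 1, 0, 0] 0 0 0 0 ![0, 0, 0, 1] i j k • e k :=
  HasBrackets.lie_eq (by simpa [IsTwoA2, Fin.sum_univ_four] using he) i j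

theorem IsA2Sum2A1.lie_eq (he : IsA2Sum2A1 e) (i j : Fin 4) :
    ⁅e i, e j⁆ = ∑ k, lieConst ![0, 1, 0, 0] 0 0 0 0 0 i j k • e k :=
  HasBrackets.lie_eq (by simpa [IsA2Sum2A1, Fin.sum_univ_four] using he) i j

theorem IsA46.lie_eq (he : IsA46 a e) (i j : Fin 4) :
    ⁅e i, e j⁆ = ∑ k, lieConst 0 0 ![a, 0, 0, 0] 0 ![0, 0, -1, 0] ![0, 1, 0, 0] i j k • e k :=
  HasBrackets.lie_eq (by simpa [IsA46, Fin.sum_univ_four] using he) i j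

theorem IsA49.lie_eq (he : IsA49 e) (i j : Fin 4) :
    ⁅e i, e j⁆ = ∑ k, lieConst 0 0 ![1 / 2, 0, 0, 0] ![1, 0, 0, 0] ![0, 1, 0, 0]
      ![0, 0, -(1 / 2), 0] i j k • e k :=
  HasBrackets.lie_eq (by simpa [IsA49, Fin.sum_univ_four] using he) i j

/-- The Killing form is `κ` times the square of the trace form `x ↦ tr (ad x)`. -/
def HasKillingRatio (L : Type*) [LieRing L] [LieAlgebra ℝ L] (κ : ℝ) : Prop :=
  (∃ x : L, LinearMap.trace ℝ L (LieAlgebra.ad ℝ L x) ≠ 0) ∧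
    ∀ x : L, LinearMap.trace ℝ L (LieAlgebra.ad ℝ L x ∘ₗ LieAlgebra.ad ℝ L x) =
      κ * LinearMap.trace ℝ L (LieAlgebra.ad ℝ L x) ^ 2

/-- The ratio separates the algebras up to the sign of a: it is 1, 1 − 2/a² and 3/2 on the second,
third and fourth, and does not exist on the first. -/
theorem HasKillingRatio.unique {κ κ' : ℝ} (h₁ : HasKillingRatio L κ) (h₂ : HasKillingRatio L κ') :
    κ = κ' := by
  obtain ⟨x, hx⟩ := h₁.1
  exact mul_right_cancel₀ (pow_ne_zero 2 hx) ((h₁.2 x).symm.trans (h₂.2 x))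

theorem IsTwoA2.not_hasKillingRatio (he : IsTwoA2 e) {κ : ℝ} : ¬HasKillingRatio L κ := by
  intro h
  -- For this element tr ad = 0, while tr ad² = 2.
  have := h.2 (e 0 - e 2)
  rw [trace_ad_ad he.lie_eq, trace_ad he.lie_eq] at this
  simp [Fin.sum_univ_four, lieConst] at this

theorem IsA2Sum2A1.hasKillingRatio (he : IsA2Sum2A1 e) : HasKillingRatio L 1 := by
  refine ⟨⟨e 0, ?_⟩, fun x => ?_⟩
  · rw [trace_ad he.lie_eq]
    simp [Fin.sum_univ_four, lieConst]
  · rw [trace_ad_ad he.lie_eq, trace_ad he.lie_eq]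
    simp [Fin.sum_univ_four, lieConst]
    ring

theorem IsA46.hasKillingRatio (he : IsA46 a e) (ha : a ≠ 0) :
    HasKillingRatio L (1 - 2 / a ^ 2) := by
  refine ⟨⟨e 3, ?_⟩, fun x => ?_⟩
  · rw [trace_ad he.lie_eq]
    simp [Fin.sum_univ_four, lieConst, ha]
  · rw [trace_ad_ad he.lie_eq, trace_ad he.lie_eq]
    simp [Fin.sum_univ_four, lieConst]
    field_simp
    ring

theorem IsA49.hasKillingRatio (he : IsA49 e) : HasKillingRatio L (3 / 2) := by
  refine ⟨⟨e 3, ?_⟩, fun x => ?_⟩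
  · rw [trace_ad he.lie_eq]
    simp [Fin.sum_univ_four, lieConst]
  · rw [trace_ad_ad he.lie_eq, trace_ad he.lie_eq]
    simp [Fin.sum_univ_four, lieConst]
    ring

theorem equivTo_of_basis {f : Basis (Fin 4) ℝ L} {c : Fin 4 → Fin 4 → Fin 4 → ℝ}
    (he : ∀ i j, ⁅e i, e j⁆ = ∑ k, c i j k • e k) (hf : ∀ i j, ⁅f i, f j⁆ = ∑ k, c i j k • f k)
    {G Φ : Matrix (Fin 4) (Fin 4) ℝ} (ht : 0 < t) (hG : ∀ i j, g.form (f i) (f j) = t ^ 2 * G i j)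
    (hΦ : ∀ i j, F (f i) (f j) = t * Φ i j) : EquivTo g F e G Φ := by
  obtain ⟨φ, hφ⟩ := exists_lieEquiv he hf
  exact ⟨φ, t, ht, by simpa [hφ] using hG, by simpa [hφ] using hΦ⟩

theorem IsProductFrame.exists_twoA2 (H : IsOrtho g h) (N : IsNormalForm F h α β)
    (hb : IsProductFrame h a b) (ha0 : a ≠ 0) (hb0 : b ≠ 0) :
    ∃ f : Basis (Fin 4) ℝ L, IsTwoA2 f ∧
      (∀ i j, g.form (f i) (f j) =
        |a|⁻¹ ^ 2 * Matrix.diagonal ![1, 1, a ^ 2 / b ^ 2, 1] i j) ∧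
      ∀ i j, F (f i) (f j) = |a|⁻¹ * ((α / a) • wedge 0 1 + (β / b) • wedge 2 3) i j := by
  -- The brackets fix the factors of the first and third vectors. The second and fourth scale freely
  -- and receive the common length t = |a|⁻¹, so that a₅ = a²/b².
  obtain ⟨f, hf⟩ := exists_scaled_basis h id Function.injective_id ![a⁻¹, |a|⁻¹, b⁻¹, |a|⁻¹]
    (by intro i; fin_cases i <;> simp [ha0, hb0])
  obtain ⟨h01, h02, h03, h12, h13, h23⟩ := hb
  refine ⟨f, ⟨?_, ?_, ?_, ?_, ?_, ?_⟩, fun i j => ?_, fun i j => ?_⟩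
  any_goals simp [hf, h01, h02, h03, h12, h13, h23, smul_smul]
  · field_simp
  · field_simp
  · fin_cases i <;> fin_cases j <;> simp [H _ _] <;> field_simp <;> simp
  · fin_cases i <;> fin_cases j <;> simp [N.apply_basis, wedge, Matrix.single] <;> field_simp <;> simp

theorem IsRotationFrame.exists_a2Sum2A1 (H : IsOrtho g h) (N : IsNormalForm F h α β)
    (hb : IsRotationFrame h b 0) (hb0 : b ≠ 0) :
    ∃ f : Basis (Fin 4) ℝ L, IsA2Sum2A1 f ∧
      (∀ i j, g.form (f i) (f j) = |b|⁻¹ ^ 2 * (1 : Matrix (Fin 4) (Fin 4) ℝ) i j) ∧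
      ∀ i j, F (f i) (f j) = |b|⁻¹ * ((β / b) • wedge 0 1 + (α / |b|) • wedge 2 3) i j := by
  obtain ⟨f, hf⟩ := exists_scaled_basis h ![2, 3, 0, 1] (by decide) ![b⁻¹, |b|⁻¹, |b|⁻¹, |b|⁻¹]
    (by intro i; fin_cases i <;> simp [hb0])
  have hsk : ∀ i j, ⁅h i, h j⁆ = -⁅h j, h i⁆ := fun i j => (lie_skew _ _).symm
  obtain ⟨h01, h02, h03, h12, h13, h23⟩ := hb
  refine ⟨f, ⟨?_, ?_, ?_, ?_, ?_, ?_⟩, fun i j => ?_, fun i j => ?_⟩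
  any_goals simp [hf, h01, h23, smul_smul, hsk 2 0, hsk 2 1, hsk 3 0, hsk 3 1, h02, h03, h12, h13,
    -lie_skew]
  · field_simp
  · fin_cases i <;> fin_cases j <;> simp [H _ _] <;> field_simp <;> simp
  · fin_cases i <;> fin_cases j <;> simp [N.apply_basis, wedge, Matrix.single] <;> field_simp <;> simp

theorem IsRotationFrame.exists_a46 (H : IsOrtho g h) (N : IsNormalForm F h α β)
    (hb : IsRotationFrame h b r) (hb0 : b ≠ 0) (ha0 : a ≠ 0) (har : a ^ 2 * r ^ 2 = b ^ 2) :
    ∃ f : Basis (Fin 4) ℝ L, IsA46 a f ∧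
      (∀ i j, g.form (f i) (f j) = |a / b| ^ 2 * (1 : Matrix (Fin 4) (Fin 4) ℝ) i j) ∧
      ∀ i j, F (f i) (f j) =
        |a / b| * ((a / b * β) • wedge 0 3 + (-(a / b * r) * |a / b| * α) • wedge 1 2) i j := by
  have hν : (a / b * r) ^ 2 = 1 := by
    field_simp
    linarith
  have hr0 : r ≠ 0 := by
    rintro rfl
    simp at har
    exact pow_ne_zero 2 hb0 har.symm
  set ν := a / b with hνdef
  have hν0 : ν ≠ 0 := div_ne_zero ha0 hb0
  have ha : a = ν * b := by rw [hνdef]; field_simp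
  -- The factor −ν of h₃ turns the eigenvalue b into a. The sign −νr = ±1 adjusts the sense of the
  -- rotation, and all vectors have length |ν|.
  obtain ⟨f, hf⟩ := exists_scaled_basis h ![3, 0, 1, 2] (by decide)
    ![|ν|, |ν|, -(ν * r) * |ν|, -ν]
    (by intro i; fin_cases i <;> simp [hν0, hr0])
  have hsk : ∀ i j, ⁅h i, h j⁆ = -⁅h j, h i⁆ := fun i j => (lie_skew _ _).symm
  obtain ⟨h01, h02, h03, h12, h13, h23⟩ := hb
  refine ⟨f, ⟨?_, ?_, ?_, ?_, ?_, ?_⟩, fun i j => ?_, fun i j => ?_⟩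
  any_goals simp [hf, h01, h23, smul_smul, hsk 3 0, hsk 3 1, hsk 3 2, h02, h03,
    h12, h13, -lie_skew]
  · rw [ha]
    congr 1
    ring
  · congr 1
    ring
  · congr 1
    linear_combination |ν| * hν
  · fin_cases i <;> fin_cases j <;> simp [H _ _, ← sq, mul_pow]
    linear_combination ν ^ 2 * hν
  · fin_cases i <;> fin_cases j <;> simp [N.apply_basis, wedge, Matrix.single] <;> ring

theorem IsHeisenbergFrame.exists_a49 (H : IsOrtho g h) (N : IsNormalForm F h α β)
    (hb : IsHeisenbergFrame h b t) (hb0 : b ≠ 0) (ht : t ^ 2 = b ^ 2) :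
    ∃ f : Basis (Fin 4) ℝ L, IsA49 f ∧
      (∀ i j, g.form (f i) (f j) = |b|⁻¹ ^ 2 * (1 : Matrix (Fin 4) (Fin 4) ℝ) i j) ∧
      ∀ i j, F (f i) (f j) = |b|⁻¹ * ((t * α / b ^ 2) • wedge 0 2 + (β / b) • wedge 1 3) i j := by
  have ht0 : t ≠ 0 := by
    rintro rfl
    simp at ht
    exact pow_ne_zero 2 hb0 ht.symm
  -- The factor −b⁻¹ of h₃ normalizes the eigenvalues. The first vector is the bracket of the second
  -- and third, and t² = b² gives it the same length |b|⁻¹.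
  obtain ⟨f, hf⟩ := exists_scaled_basis h ![0, 3, 1, 2] (by decide)
    ![t * (b ^ 2)⁻¹, |b|⁻¹, |b|⁻¹, -b⁻¹]
    (by intro i; fin_cases i <;> simp [hb0, ht0])
  have hsk : ∀ i j, ⁅h i, h j⁆ = -⁅h j, h i⁆ := fun i j => (lie_skew _ _).symm
  obtain ⟨h01, h02, h03, h12, h13, h23⟩ := hb
  refine ⟨f, ⟨?_, ?_, ?_, ?_, ?_, ?_⟩, fun i j => ?_, fun i j => ?_⟩
  any_goals simp [hf, h01, h23, smul_smul, hsk 3 1, hsk 3 2, h02, h03,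
    h12, h13, -lie_skew]
  · congr 1
    field_simp
  · congr 1
    rw [← mul_assoc, ← sq, inv_pow, sq_abs, mul_comm]
  · congr 1
    field_simp
  · congr 1
    field_simp
  · fin_cases i <;> fin_cases j <;> simp [H _ _, ← sq, mul_pow]
    field_simp
    linear_combination ht
  · fin_cases i <;> fin_cases j <;> simp [N.apply_basis, wedge, Matrix.single] <;>
      field_simp <;> simp

end EinsteinMaxwell

/-! ### From the listed pairs back to adapted frames -/

namespace EinsteinMaxwell

open Module

variable {L : Type*} [LieRing L] [LieAlgebra ℝ L] {g : Metric L}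
  {F : LinearMap.BilinForm ℝ L} {h e : Basis (Fin 4) ℝ L} {α β a b r t : ℝ}

theorem isNormalForm_of_matrix
    (hF : ∀ i j, F (h i) (h j) = (α • wedge 0 1 + β • wedge 2 3) i j) :
    IsNormalForm F h α β := by
  have halt : F = -F.flip := by
    refine LinearMap.BilinForm.ext_basis h fun i j => ?_
    rw [LinearMap.neg_apply, LinearMap.neg_apply, LinearMap.BilinForm.flip_apply, hF, hF]
    fin_cases i <;> fin_cases j <;> simp [wedge, Matrix.single]
  refine ⟨fun x => ?_, ?_, ?_, ?_, ?_, ?_, ?_⟩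
  · have := congrArg (fun B : LinearMap.BilinForm ℝ L => B x x) halt
    simp at this
    linarith
  all_goals simp [hF, wedge, Matrix.single]

theorem EquivTo.exists_basis {G Φ : Matrix (Fin 4) (Fin 4) ℝ} (E : EquivTo g F e G Φ) :
    ∃ (φ : L ≃ₗ⁅ℝ⁆ L) (f : Basis (Fin 4) ℝ L) (t : ℝ), (∀ i, f i = φ (e i)) ∧ 0 < t ∧
      (∀ i j, g.form (f i) (f j) = t ^ 2 * G i j) ∧ ∀ i j, F (f i) (f j) = t * Φ i j := by
  obtain ⟨φ, t, ht, hG, hΦ⟩ := E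
  have hf : ∀ i, e.map φ.toLinearEquiv i = φ (e i) := fun i => by simp
  exact ⟨φ, e.map φ.toLinearEquiv, t, hf, ht, by simpa only [hf] using hG,
    by simpa only [hf] using hΦ⟩

theorem HasBrackets.map {f : Basis (Fin 4) ℝ L} (φ : L ≃ₗ⁅ℝ⁆ L) (hf : ∀ i, f i = φ (e i))
    {v₁ v₂ v₃ v₄ v₅ v₆ : L} (he : HasBrackets e v₁ v₂ v₃ v₄ v₅ v₆) :
    HasBrackets f (φ v₁) (φ v₂) (φ v₃) (φ v₄) (φ v₅) (φ v₆) := by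
  obtain ⟨rfl, rfl, rfl, rfl, rfl, rfl⟩ := he
  simp [HasBrackets, hf, LieEquiv.map_lie]

variable [FiniteDimensional ℝ L]

theorem EquivTo.exists_productFrame (he : IsTwoA2 e) {a₁₂ a₃₄ a₅ : ℝ}
    (ha : a₅ = (1 + a₃₄ ^ 2) / (1 + a₁₂ ^ 2)) (ha1 : a₅ ≠ 1)
    (E : EquivTo g F e (Matrix.diagonal ![1, 1, a₅, 1]) (a₁₂ • wedge 0 1 + a₃₄ • wedge 2 3)) :
    ∃ h α β a b, IsAdapted g F h α β ∧ IsProductFrame h a b := by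
  obtain ⟨φ, f, t, hf, ht, hG, hΦ⟩ := E.exists_basis
  have hb := HasBrackets.map φ hf he
  simp only [map_zero, ← hf] at hb
  obtain ⟨h01, h02, h03, h12, h13, h23⟩ := hb
  have hpos : 0 < a₅ := by rw [ha]; positivity
  have hsq := Real.sq_sqrt hpos.le
  have hne : √a₅ ≠ 0 := (Real.sqrt_pos.mpr hpos).ne'
  have ha' : a₅ * (1 + a₁₂ ^ 2) = 1 + a₃₄ ^ 2 := by rw [ha]; field_simp
  have ht0 := ht.ne'
  obtain ⟨h, hh⟩ := exists_scaled_basis f id Function.injective_id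
    ![t⁻¹, t⁻¹, (t * √a₅)⁻¹, t⁻¹] (by intro i; fin_cases i <;> simp [hne, ht0])
  have H : IsOrtho g h := by
    intro i j
    simp only [hh, map_smul, LinearMap.smul_apply, smul_eq_mul, id, hG]
    fin_cases i <;> fin_cases j <;> simp <;> field_simp
    exact hsq.symm
  have N : IsNormalForm F h (a₁₂ / t) (a₃₄ / (t * √a₅)) := by
    refine isNormalForm_of_matrix fun i j => ?_
    simp only [hh, map_smul, LinearMap.smul_apply, smul_eq_mul, id, hΦ]
    fin_cases i <;> fin_cases j <;> simp [wedge, Matrix.single] <;> field_simp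
  have hb : IsProductFrame h (t⁻¹) ((t * √a₅)⁻¹) := by
    refine ⟨?_, ?_, ?_, ?_, ?_, ?_⟩ <;>
      simp [hh, h01, h02, h03, h12, h13, h23] <;> module
  refine ⟨h, _, _, _, _, IsProductFrame.isAdapted H N hb ?_ ?_, hb⟩
  · rw [div_pow, div_pow, inv_pow, inv_pow, mul_pow, hsq]
    field_simp
    linarith
  · rw [inv_pow, inv_pow, mul_pow, hsq]
    intro h
    apply ha1
    field_simp at h
    linarith

theorem EquivTo.exists_rotationFrame_of_a2Sum2A1 (he : IsA2Sum2A1 e) {a₁₂ a₃₄ : ℝ}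
    (ha : a₃₄ ^ 2 - a₁₂ ^ 2 = 1) (E : EquivTo g F e 1 (a₁₂ • wedge 0 1 + a₃₄ • wedge 2 3)) :
    ∃ h α β b r, IsAdapted g F h α β ∧ IsRotationFrame h b r := by
  obtain ⟨φ, f, t, hf, ht, hG, hΦ⟩ := E.exists_basis
  have hb := HasBrackets.map φ hf he
  simp only [map_zero, ← hf] at hb
  obtain ⟨h01, h02, h03, h12, h13, h23⟩ := hb
  have ht0 := ht.ne'
  have hsk : ∀ i j, ⁅f i, f j⁆ = -⁅f j, f i⁆ := fun i j => (lie_skew _ _).symm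
  obtain ⟨h, hh⟩ := exists_scaled_basis f ![2, 3, 0, 1] (by decide) (fun _ => t⁻¹) (by simp [ht0])
  have H : IsOrtho g h := by
    intro i j
    simp only [hh, map_smul, LinearMap.smul_apply, smul_eq_mul, hG]
    fin_cases i <;> fin_cases j <;> simp [Matrix.one_apply] <;> field_simp
  have N : IsNormalForm F h (a₃₄ / t) (a₁₂ / t) := by
    refine isNormalForm_of_matrix fun i j => ?_
    simp only [hh, map_smul, LinearMap.smul_apply, smul_eq_mul, hΦ]
    fin_cases i <;> fin_cases j <;> simp [wedge, Matrix.single] <;> field_simp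
  have hb : IsRotationFrame h (t⁻¹) 0 := by
    refine ⟨?_, ?_, ?_, ?_, ?_, ?_⟩ <;>
      simp [hh, h01, hsk 2 0, hsk 2 1, hsk 3 0, hsk 3 1, h02, h03, h12, h13, h23, -lie_skew]
  refine ⟨h, _, _, _, _, IsRotationFrame.isAdapted H N hb ?_ (inv_ne_zero ht0), hb⟩
  field_simp
  linarith

theorem EquivTo.exists_rotationFrame_of_a46 (he : IsA46 a e) (ha0 : a ≠ 0) {a₁₄ a₂₃ : ℝ}
    (ha : a₂₃ ^ 2 - a₁₄ ^ 2 = a ^ 2) (E : EquivTo g F e 1 (a₁₄ • wedge 0 3 + a₂₃ • wedge 1 2)) :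
    ∃ h α β b r, IsAdapted g F h α β ∧ IsRotationFrame h b r := by
  obtain ⟨φ, f, t, hf, ht, hG, hΦ⟩ := E.exists_basis
  have hb := HasBrackets.map φ hf he
  simp only [map_zero, map_neg, map_smul, ← hf] at hb
  obtain ⟨h01, h02, h03, h12, h13, h23⟩ := hb
  have ht0 := ht.ne'
  have hsk : ∀ i j, ⁅f i, f j⁆ = -⁅f j, f i⁆ := fun i j => (lie_skew _ _).symm
  obtain ⟨h, hh⟩ := exists_scaled_basis f ![1, 2, 3, 0] (by decide) (fun _ => t⁻¹) (by simp [ht0])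
  have H : IsOrtho g h := by
    intro i j
    simp only [hh, map_smul, LinearMap.smul_apply, smul_eq_mul, hG]
    fin_cases i <;> fin_cases j <;> simp [Matrix.one_apply] <;> field_simp
  have N : IsNormalForm F h (a₂₃ / t) (-a₁₄ / t) := by
    refine isNormalForm_of_matrix fun i j => ?_
    simp only [hh, map_smul, LinearMap.smul_apply, smul_eq_mul, hΦ]
    fin_cases i <;> fin_cases j <;> simp [wedge, Matrix.single] <;> field_simp
  have hb : IsRotationFrame h (-a / t) t⁻¹ := by
    refine ⟨?_, ?_, ?_, ?_, ?_, ?_⟩ <;>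
      simp [hh, h01, hsk 1 0, hsk 2 0, hsk 3 0, h02, h03, h12, h13, h23, -lie_skew, smul_smul,
        div_eq_inv_mul] <;> module
  refine ⟨h, _, _, _, _, IsRotationFrame.isAdapted H N hb ?_ ?_, hb⟩
  · field_simp
    linarith
  · simp [ha0, ht0]

/-- The explicit relation between h and f is retained for the orientation: the permutation is a
3-cycle, hence even, and the factor is positive. -/
theorem EquivTo.exists_heisenbergFrame (he : IsA49 e) {a₁₃ a₂₄ : ℝ}
    (ha : a₁₃ ^ 2 - a₂₄ ^ 2 = 3 / 2) (E : EquivTo g F e 1 (a₁₃ • wedge 0 2 + a₂₄ • wedge 1 3)) :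
    ∃ (f h : Basis (Fin 4) ℝ L) (α β t : ℝ), IsA49 f ∧ 0 < t ∧ (∀ i, h i = t • f (![0, 2, 3, 1] i)) ∧
      IsAdapted g F h α β ∧ IsHeisenbergFrame h (-t) t := by
  obtain ⟨φ, f, t, hf, ht, hG, hΦ⟩ := E.exists_basis
  have hb := HasBrackets.map φ hf he
  simp only [map_zero, map_smul, ← hf] at hb
  refine ⟨f, ?_⟩
  have hfb : IsA49 f := hb
  obtain ⟨h01, h02, h03, h12, h13, h23⟩ := hb
  have ht0 := ht.ne'
  have hsk : ∀ i j, ⁅f i, f j⁆ = -⁅f j, f i⁆ := fun i j => (lie_skew _ _).symm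
  obtain ⟨h, hh⟩ := exists_scaled_basis f ![0, 2, 3, 1] (by decide) (fun _ => t⁻¹) (by simp [ht0])
  have H : IsOrtho g h := by
    intro i j
    simp only [hh, map_smul, LinearMap.smul_apply, smul_eq_mul, hG]
    fin_cases i <;> fin_cases j <;> simp [Matrix.one_apply] <;> field_simp
  have N : IsNormalForm F h (a₁₃ / t) (-a₂₄ / t) := by
    refine isNormalForm_of_matrix fun i j => ?_
    simp only [hh, map_smul, LinearMap.smul_apply, smul_eq_mul, hΦ]
    fin_cases i <;> fin_cases j <;> simp [wedge, Matrix.single] <;> field_simp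
  have hb : IsHeisenbergFrame h (-t⁻¹) t⁻¹ := by
    refine ⟨?_, ?_, ?_, ?_, ?_, ?_⟩ <;>
      simp [hh, h01, hsk 2 1, hsk 3 1, h02, h03, h12, h13, h23, -lie_skew, smul_smul,
        div_eq_inv_mul] <;> module
  refine ⟨h, _, _, t⁻¹, hfb, inv_pos.mpr ht, hh,
    IsHeisenbergFrame.isAdapted H N hb (by ring) ?_ (by simp [ht0]), hb⟩
  field_simp
  linarith

end EinsteinMaxwell

/-! ### Almost-Kähler structures and integrability -/

namespace EinsteinMaxwell

open Module

variable {L : Type*} [LieRing L] [LieAlgebra ℝ L] {g : Metric L}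
  {F : LinearMap.BilinForm ℝ L} {h e : Basis (Fin 4) ℝ L} {α β a b r t ε : ℝ}

/-- The Pfaffian of a 2-form in a basis. -/
noncomputable def pfaffian (ω : LinearMap.BilinForm ℝ L) (e : Basis (Fin 4) ℝ L) : ℝ :=
  ω (e 0) (e 1) * ω (e 2) (e 3) - ω (e 0) (e 2) * ω (e 1) (e 3) + ω (e 0) (e 3) * ω (e 1) (e 2)

theorem det_fin_four (M : Matrix (Fin 4) (Fin 4) ℝ) : M.det =
    M 0 0 * (M 1 1 * (M 2 2 * M 3 3 - M 2 3 * M 3 2) - M 1 2 * (M 2 1 * M 3 3 - M 2 3 * M 3 1) +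
      M 1 3 * (M 2 1 * M 3 2 - M 2 2 * M 3 1)) -
    M 0 1 * (M 1 0 * (M 2 2 * M 3 3 - M 2 3 * M 3 2) - M 1 2 * (M 2 0 * M 3 3 - M 2 3 * M 3 0) +
      M 1 3 * (M 2 0 * M 3 2 - M 2 2 * M 3 0)) +
    M 0 2 * (M 1 0 * (M 2 1 * M 3 3 - M 2 3 * M 3 1) - M 1 1 * (M 2 0 * M 3 3 - M 2 3 * M 3 0) +
      M 1 3 * (M 2 0 * M 3 1 - M 2 1 * M 3 0)) -
    M 0 3 * (M 1 0 * (M 2 1 * M 3 2 - M 2 2 * M 3 1) - M 1 1 * (M 2 0 * M 3 2 - M 2 2 * M 3 0) +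
      M 1 2 * (M 2 0 * M 3 1 - M 2 1 * M 3 0)) := by
  simp [Matrix.det_succ_row_zero, Fin.sum_univ_succ, Fin.succAbove]
  ring

/-- The Pfaffian is half the value of the 4-form ω ∧ ω on the basis, hence scales by the
determinant. -/
theorem pfaffian_eq_det_mul {ω : LinearMap.BilinForm ℝ L} (hω : ∀ x, ω x x = 0)
    (h e : Basis (Fin 4) ℝ L) : pfaffian ω e = h.det e * pfaffian ω h := by
  have hsk := apply_swap_of_alt hω
  have key : ∀ x y, ω x y =
      (h.repr x 0 * h.repr y 1 - h.repr x 1 * h.repr y 0) * ω (h 0) (h 1) +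
      (h.repr x 0 * h.repr y 2 - h.repr x 2 * h.repr y 0) * ω (h 0) (h 2) +
      (h.repr x 0 * h.repr y 3 - h.repr x 3 * h.repr y 0) * ω (h 0) (h 3) +
      (h.repr x 1 * h.repr y 2 - h.repr x 2 * h.repr y 1) * ω (h 1) (h 2) +
      (h.repr x 1 * h.repr y 3 - h.repr x 3 * h.repr y 1) * ω (h 1) (h 3) +
      (h.repr x 2 * h.repr y 3 - h.repr x 3 * h.repr y 2) * ω (h 2) (h 3) := by
    intro x y
    conv_lhs => rw [← h.sum_repr x, ← h.sum_repr y]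
    simp only [Fin.sum_univ_four, map_add, map_smul, LinearMap.add_apply, LinearMap.smul_apply,
      smul_eq_mul, hω, hsk (h 1) (h 0), hsk (h 2) (h 0), hsk (h 3) (h 0), hsk (h 2) (h 1),
      hsk (h 3) (h 1), hsk (h 3) (h 2)]
    ring
  simp only [pfaffian, key (e _), Basis.det_apply, det_fin_four, Basis.toMatrix_apply]
  ring

/-- The almost complex structure `h₁ ↦ h₂`, `h₃ ↦ ε h₄` for `ε = ± 1`. -/
noncomputable def frameJ (h : Basis (Fin 4) ℝ L) (ε : ℝ) : L →ₗ[ℝ] L :=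
  h.constr ℝ ![h 1, -h 0, ε • h 3, -ε • h 2]

theorem frameJ_zero : frameJ h ε (h 0) = h 1 := by simp [frameJ]
theorem frameJ_one : frameJ h ε (h 1) = -h 0 := by simp [frameJ]
theorem frameJ_two : frameJ h ε (h 2) = ε • h 3 := by simp [frameJ]
theorem frameJ_three : frameJ h ε (h 3) = -ε • h 2 := by simp [frameJ]

theorem form_frameJ (H : IsOrtho g h) (x y : L) : g.form (frameJ h ε x) y =
    planeForm g h 0 1 x y + ε * planeForm g h 2 3 x y := by
  conv_lhs => rw [← H.sum_form x, ← H.sum_form y]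
  simp [Fin.sum_univ_four, frameJ_zero, frameJ_one, frameJ_two, frameJ_three, H _ _, planeForm]
  ring

theorem frameJ_frameJ (hε : ε ^ 2 = 1) (x : L) : frameJ h ε (frameJ h ε x) = -x := by
  suffices frameJ h ε ∘ₗ frameJ h ε = -LinearMap.id by
    simpa using congrArg (fun A : L →ₗ[ℝ] L => A x) this
  refine h.ext fun i => ?_
  fin_cases i <;>
    simp [frameJ_zero, frameJ_one, frameJ_two, frameJ_three, smul_smul, ← sq, hε]

theorem form_frameJ_frameJ (H : IsOrtho g h) (hε : ε ^ 2 = 1) (x y : L) :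
    g.form (frameJ h ε x) (frameJ h ε y) = g.form x y := by
  suffices g.form.compl₁₂ (frameJ h ε) (frameJ h ε) = g.form by
    simpa using congrArg (fun B : LinearMap.BilinForm ℝ L => B x y) this
  refine LinearMap.BilinForm.ext_basis h fun i j => ?_
  fin_cases i <;> fin_cases j <;>
    simp [frameJ_zero, frameJ_one, frameJ_two, frameJ_three, H _ _, ← sq, hε]

/-- The fundamental form is h¹² + ε h³⁴, with Pfaffian ε in h; the two signs serve the two
orientations. -/
theorem isAlmostKahler_frameJ (H : IsOrtho g h) (h₁ : ClosedForm (planeForm g h 0 1))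
    (h₂ : ClosedForm (planeForm g h 2 3)) (hε : ε ^ 2 = 1) (he : 0 < ε * h.det e) :
    IsAlmostKahler g e (frameJ h ε) := by
  refine ⟨frameJ_frameJ hε, form_frameJ_frameJ H hε, fun x y z => ?_, ?_⟩
  · simp only [form_frameJ H]
    linear_combination h₁ x y z + ε * h₂ x y z
  · have halt : ∀ x, (g.form ∘ₗ frameJ h ε) x x = 0 := by
      intro x
      simp only [LinearMap.comp_apply, form_frameJ H, planeForm]
      ring
    have hpf := pfaffian_eq_det_mul halt h e
    simp only [pfaffian, LinearMap.comp_apply] at hpf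
    rw [hpf]
    simp [frameJ_zero, frameJ_one, frameJ_two, H _ _]
    linarith

theorem isIntegrable_of_basis {J : L →ₗ[ℝ] L}
    (hJ : ∀ i j, ⁅J (h i), J (h j)⁆ - J ⁅J (h i), h j⁆ - J ⁅h i, J (h j)⁆ - ⁅h i, h j⁆ = 0) :
    IsIntegrable J := by
  set N : L →ₗ[ℝ] L →ₗ[ℝ] L :=
    LinearMap.mk₂ ℝ (fun x y => ⁅J x, J y⁆ - J ⁅J x, y⁆ - J ⁅x, J y⁆ - ⁅x, y⁆)
      (fun x x' y => by simp; abel) (fun c x y => by simp [smul_sub])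
      (fun x y y' => by simp; abel) (fun c x y => by simp [smul_sub]) with hN
  have : N = 0 := by
    refine h.ext fun i => h.ext fun j => ?_
    simpa [hN] using hJ i j
  intro x y
  simpa [hN] using congrArg (fun N : L →ₗ[ℝ] L →ₗ[ℝ] L => N x y) this

theorem IsProductFrame.isIntegrable (hb : IsProductFrame h a b) (hε : ε ^ 2 = 1) :
    IsIntegrable (frameJ h ε) := by
  have hε' : ∀ c, ε * (ε * c) = c := fun c => by linear_combination c * hε
  obtain ⟨h01, h02, h03, h12, h13, h23⟩ := hb
  have hsk : ∀ i j, ⁅h i, h j⁆ = -⁅h j, h i⁆ := fun i j => (lie_skew _ _).symm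
  refine isIntegrable_of_basis (h := h) fun i j => ?_
  fin_cases i <;> fin_cases j <;>
    simp [frameJ_zero, frameJ_one, frameJ_two, frameJ_three, h01, h02, h03, h12, h13, h23,
      hsk 1 0, hsk 2 0, hsk 3 0, hsk 2 1, hsk 3 1, hsk 3 2, -lie_skew, smul_smul, hε']

theorem IsRotationFrame.isIntegrable (hb : IsRotationFrame h b r) (hε : ε ^ 2 = 1) :
    IsIntegrable (frameJ h ε) := by
  have hε' : ∀ c, ε * (ε * c) = c := fun c => by linear_combination c * hε
  obtain ⟨h01, h02, h03, h12, h13, h23⟩ := hb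
  have hsk : ∀ i j, ⁅h i, h j⁆ = -⁅h j, h i⁆ := fun i j => (lie_skew _ _).symm
  refine isIntegrable_of_basis (h := h) fun i j => ?_
  fin_cases i <;> fin_cases j <;>
    simp [frameJ_zero, frameJ_one, frameJ_two, frameJ_three, h01, h02, h03, h12, h13, h23,
      hsk 1 0, hsk 2 0, hsk 3 0, hsk 2 1, hsk 3 1, hsk 3 2, -lie_skew, smul_smul, hε']

theorem IsHeisenbergFrame.isIntegrable (hb : IsHeisenbergFrame h (-t) t) :
    IsIntegrable (frameJ h (-1)) := by
  obtain ⟨h01, h02, h03, h12, h13, h23⟩ := hb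
  have hsk : ∀ i j, ⁅h i, h j⁆ = -⁅h j, h i⁆ := fun i j => (lie_skew _ _).symm
  refine isIntegrable_of_basis (h := h) fun i j => ?_
  fin_cases i <;> fin_cases j <;>
    simp [frameJ_zero, frameJ_one, frameJ_two, frameJ_three, h01, h02, h03, h12, h13, h23,
      hsk 1 0, hsk 2 0, hsk 3 0, hsk 2 1, hsk 3 1, hsk 3 2, -lie_skew] <;> module

theorem repr_lie {c : Fin 4 → Fin 4 → Fin 4 → ℝ}
    (he : ∀ i j, ⁅e i, e j⁆ = ∑ k, c i j k • e k) (x y : L) (k : Fin 4) :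
    e.repr ⁅x, y⁆ k = ∑ i, ∑ j, e.repr x i * e.repr y j * c i j k := by
  conv_lhs => rw [← e.sum_repr x, ← e.sum_repr y]
  simp only [sum_lie, lie_sum, smul_lie, lie_smul, he, map_sum, map_smul, Finsupp.coe_finsetSum,
    Finset.sum_apply, Finsupp.smul_apply, Basis.repr_self, Finsupp.single_apply, smul_eq_mul]
  simp only [mul_ite, mul_one, mul_zero, Finset.sum_ite_eq', Finset.mem_univ, if_true,
    Finset.mul_sum]
  rw [Finset.sum_comm]
  exact Finset.sum_congr rfl fun i _ => Finset.sum_congr rfl fun j _ => by ring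

/-- Automorphisms of `A_{4,9}^{-1/2}` preserve the orientation. -/
theorem IsA49.det_pos {f : Basis (Fin 4) ℝ L} (he : IsA49 e) (hf : IsA49 f) : 0 < e.det f := by
  obtain ⟨-, -, f03, f12, f13, f23⟩ := hf
  have hr := repr_lie he.lie_eq
  have hr0 := fun x y => hr x y 0
  have hr1 := fun x y => hr x y 1
  have hr2 := fun x y => hr x y 2
  have hr3 := fun x y => hr x y 3
  simp [lieConst, Fin.sum_univ_four] at hr0 hr1 hr2 hr3
  -- The first three vectors of f are multiples of brackets, so they lie in the Heisenberg ideal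
  -- ⟨e₁, e₂, e₃⟩. The first is a bracket of two elements of this ideal, so it is a multiple of e₁.
  have z0 : e.repr (f 0) 3 = 0 := by rw [← f12, hr3]
  have z1 : e.repr (f 1) 3 = 0 := by rw [← f13, hr3]
  have z2 : e.repr (f 2) 3 = 0 := by
    have := hr3 (f 2) (f 3)
    rw [f23] at this
    simpa using this
  have y1 : e.repr (f 0) 1 = 0 := by rw [← f12, hr1, z1, z2]; ring
  have y2 : e.repr (f 0) 2 = 0 := by rw [← f12, hr2, z1, z2]; ring
  have m := hr0 (f 1) (f 2)
  rw [f12, z1, z2] at m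
  have d := hr0 (f 0) (f 3)
  rw [f03, z0, y1, y2] at d
  simp at d
  have hm : e.repr (f 0) 0 ≠ 0 := by
    intro h0
    refine f.ne_zero 0 (e.repr.map_eq_zero_iff.mp (Finsupp.ext fun i => ?_))
    fin_cases i <;> simp [z0, y1, y2, h0]
  have hd : e.repr (f 3) 3 = 1 := mul_left_cancel₀ hm (by linarith)
  -- The matrix is block triangular with blocks m, a 2×2 block and 1. Since [f₂, f₃] = f₁, the 2×2
  -- minor is again m.
  have : e.det f = e.repr (f 0) 0 ^ 2 := by
    rw [Basis.det_apply, det_fin_four]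
    simp only [Basis.toMatrix_apply, z0, z1, z2, y1, y2, hd]
    linear_combination -e.repr (f 0) 0 * m
  rw [this]
  positivity

variable [FiniteDimensional ℝ L]

theorem IsAdapted.exists_isKahler (A : IsAdapted g F h α β) (e : Basis (Fin 4) ℝ L)
    (hJ : ∀ ε : ℝ, ε ^ 2 = 1 → IsIntegrable (frameJ h ε)) : ∃ J, IsKahler g e J := by
  have h0 : h.det e ≠ 0 := (h.isUnit_det e).ne_zero
  have hε : SignType.sign (h.det e) ^ 2 = (1 : ℝ) := by
    rcases lt_or_gt_of_ne h0 with h0 | h0 <;> simp [h0]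
  exact ⟨_, isAlmostKahler_frameJ A.ortho A.closed01 A.closed23 hε
    (by rw [sign_mul_self]; exact abs_pos.mpr h0), hJ _ hε⟩

/-- J preserves the two planes, and Ric is a multiple of g on each of them with no mixed part. -/
theorem IsAdapted.ricci_frameJ (A : IsAdapted g F h α β) (hε : ε ^ 2 = 1) (x y : L) :
    g.ricci (frameJ h ε x) (frameJ h ε y) = g.ricci x y := by
  obtain ⟨h0, h1, h2, -⟩ := (einsteinMaxwell_iff A.ortho A.normal).mp A.em
  suffices g.ricci.compl₁₂ (frameJ h ε) (frameJ h ε) = g.ricci by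
    simpa using congrArg (fun B : LinearMap.BilinForm ℝ L => B x y) this
  have hε' : ∀ c, ε * (ε * c) = c := fun c => by linear_combination c * hε
  refine LinearMap.BilinForm.ext_basis h fun i j => ?_
  fin_cases i <;> fin_cases j <;>
    simp [frameJ_zero, frameJ_one, frameJ_two, frameJ_three, h0, h1, h2, hε']

omit [FiniteDimensional ℝ L] in
/-- An almost Kähler structure for the orientation of a Heisenberg frame is the standard one up to
sign, which is not integrable. -/
theorem IsHeisenbergFrame.not_isKahler (H : IsOrtho g h) (hb : IsHeisenbergFrame h (-t) t)
    (ht : t ≠ 0) (he : 0 < h.det e) {J : L →ₗ[ℝ] L} : ¬IsKahler g e J := by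
  rintro ⟨⟨hsq, horth, hcl, hor⟩, hint⟩
  have hskew : ∀ x y, g.form (J x) y = -g.form (J y) x := by
    intro x y
    rw [← horth (J x) y, hsq, map_neg, LinearMap.neg_apply, g.symm]
  have halt : ∀ x, (g.form ∘ₗ J) x x = 0 := by
    intro x
    have := hskew x x
    simp only [LinearMap.comp_apply]
    linarith
  have hpf : 0 < pfaffian (g.form ∘ₗ J) h := by
    have : 0 < pfaffian (g.form ∘ₗ J) e := hor
    rw [pfaffian_eq_det_mul halt h e] at this
    exact pos_of_mul_pos_right this he.le
  have hnorm : ∀ i j, ∑ k, g.form (J (h i)) (h k) * g.form (J (h j)) (h k) =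
      if i = j then 1 else 0 := by
    intro i j
    rw [← H i j, ← horth (h i) (h j)]
    conv_rhs => rw [← H.sum_form (J (h j))]
    simp [mul_comm]
  obtain ⟨h01, h02, h03, h12, h13, h23⟩ := id hb
  have hs : ∀ i j, ⁅h i, h j⁆ = -⁅h j, h i⁆ := fun i j => (lie_skew _ _).symm
  have c1 := hcl (h 0) (h 2) (h 3)
  have c2 := hcl (h 1) (h 2) (h 3)
  simp [h02, h03, h12, h13, h23, hs 3 0, hs 3 1, -lie_skew] at c1 c2
  have n00 := hnorm 0 0
  have n11 := hnorm 1 1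
  have n22 := hnorm 2 2
  have n33 := hnorm 3 3
  have d : ∀ i, g.form (J (h i)) (h i) = 0 := fun i => halt (h i)
  simp [Fin.sum_univ_four, d, hskew (h 1) (h 0), hskew (h 2) (h 0), hskew (h 3) (h 0),
    hskew (h 2) (h 1), hskew (h 3) (h 1), hskew (h 3) (h 2)] at n00 n11 n22 n33
  simp only [pfaffian, LinearMap.comp_apply] at hpf
  rw [hskew (h 3) (h 0)] at c1
  rw [hskew (h 3) (h 1)] at c2
  have s0 := H.sum_form (J (h 0))
  have s3 := H.sum_form (J (h 3))
  simp only [Fin.sum_univ_four, d, hskew (h 3) (h 0), hskew (h 3) (h 1), hskew (h 3) (h 2)] at s0 s3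
  have s1 := H.sum_form (J (h 1))
  simp only [Fin.sum_univ_four, d, hskew (h 1) (h 0)] at s1
  generalize g.form (J (h 0)) (h 1) = A at *
  generalize g.form (J (h 0)) (h 2) = B at *
  generalize g.form (J (h 0)) (h 3) = C at *
  generalize g.form (J (h 1)) (h 2) = D at *
  generalize g.form (J (h 1)) (h 3) = E at *
  generalize g.form (J (h 2)) (h 3) = G at *
  -- Closedness gives C = 0 and E = −2B. Comparing the unit lengths of Jh₁ and Jh₂ then gives 3B² +
  -- D² = 0, and positivity of the Pfaffian AG selects G = A.
  obtain rfl : C = 0 := mul_left_cancel₀ ht (by linarith)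
  obtain rfl : E = -2 * B := mul_left_cancel₀ ht (by linarith)
  obtain rfl : B = 0 := by nlinarith [sq_nonneg B, sq_nonneg D]
  obtain rfl : D = 0 := by nlinarith [sq_nonneg D]
  obtain rfl : G = A := by
    rcases mul_self_eq_mul_self_iff.mp (show G * G = A * A by linarith) with h | h
    · exact h
    · subst h
      nlinarith
  simp at s0 s1 s3 n00
  -- This component of the Nijenhuis tensor is 2tA², and A² = 1.
  have hN := congrArg (fun v => g.form v (h 1)) (hint (h 0) (h 3))
  simp [← s0, ← s3, h02, h03, h12, h13, H _ _, -lie_skew] at hN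
  apply ht
  linear_combination hN / 2 - t * n00

end EinsteinMaxwell

/-! ### Solutions on each algebra -/

namespace EinsteinMaxwell

open Module

variable {L : Type*} [LieRing L] [LieAlgebra ℝ L] {g : Metric L}
  {F : LinearMap.BilinForm ℝ L} {h e : Basis (Fin 4) ℝ L} {α β a b r t κ : ℝ}

/-- The inner product with a given diagonal matrix. -/
noncomputable def diagonalMetric (e : Basis (Fin 4) ℝ L) (d : Fin 4 → ℝ) (hd : ∀ i, 0 < d i) :
    Metric L where
  form := Matrix.toBilin e (Matrix.diagonal d)
  symm x y := by
    simp only [Matrix.toBilin_apply, Matrix.diagonal_apply, Fin.sum_univ_four]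
    simp
    ring
  pos x hx := by
    have : Matrix.toBilin e (Matrix.diagonal d) x x = ∑ i, d i * e.repr x i ^ 2 := by
      simp only [Matrix.toBilin_apply, Matrix.diagonal_apply, Fin.sum_univ_four]
      simp
      ring
    rw [this]
    refine Finset.sum_pos' (fun i _ => mul_nonneg (hd i).le (sq_nonneg _)) ?_
    by_contra! hc
    refine hx (e.repr.map_eq_zero_iff.mp (Finsupp.ext fun i => ?_))
    by_contra hi
    exact (mul_pos (hd i) (sq_pos_of_ne_zero hi)).not_ge (hc i (Finset.mem_univ i))

theorem exists_equivTo (e : Basis (Fin 4) ℝ L) (d : Fin 4 → ℝ) (hd : ∀ i, 0 < d i)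
    (Φ : Matrix (Fin 4) (Fin 4) ℝ) : ∃ (g : Metric L) (F : LinearMap.BilinForm ℝ L),
      EquivTo g F e (Matrix.diagonal d) Φ := by
  refine ⟨diagonalMetric e d hd, Matrix.toBilin e Φ, LieEquiv.refl, 1, one_pos, fun i j => ?_,
    fun i j => ?_⟩ <;> simp [diagonalMetric, Matrix.toBilin_apply, Finsupp.single_apply]

theorem IsRotationFrame.hasKillingRatio (H : IsOrtho g h) (N : IsNormalForm F h α β)
    (hb : IsRotationFrame h b r) (hb0 : b ≠ 0) : HasKillingRatio L (1 - 2 * r ^ 2 / b ^ 2) := by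
  by_cases hr : r = 0
  · subst hr
    obtain ⟨f, hf, -⟩ := hb.exists_a2Sum2A1 H N hb0
    simpa using hf.hasKillingRatio
  · have ha : b / r ≠ 0 := div_ne_zero hb0 hr
    obtain ⟨f, hf, -⟩ := hb.exists_a46 H N hb0 ha (by field_simp)
    convert hf.hasKillingRatio ha using 2
    field_simp

theorem IsHeisenbergFrame.hasKillingRatio (H : IsOrtho g h) (N : IsNormalForm F h α β)
    (hb : IsHeisenbergFrame h b t) (hb0 : b ≠ 0) (ht : t ^ 2 = b ^ 2) :
    HasKillingRatio L (3 / 2) := by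
  obtain ⟨f, hf, -⟩ := hb.exists_a49 H N hb0 ht
  exact hf.hasKillingRatio

theorem IsProductFrame.not_hasKillingRatio (H : IsOrtho g h) (N : IsNormalForm F h α β)
    (hb : IsProductFrame h a b) (ha0 : a ≠ 0) (hb0 : b ≠ 0) : ¬HasKillingRatio L κ := by
  obtain ⟨f, hf, -⟩ := hb.exists_twoA2 H N ha0 hb0
  exact hf.not_hasKillingRatio

variable [FiniteDimensional ℝ L]

namespace IsAdapted

theorem exists_productFrame (A : IsAdapted g F h α β) (hL : ¬∃ κ, HasKillingRatio L κ) :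
    ∃ h' α' β' a b, IsAdapted g F h' α' β' ∧ a ≠ 0 ∧ b ≠ 0 ∧ IsProductFrame h' a b := by
  obtain ⟨h', α', β', A', ⟨a, b, ha, hb, hf⟩ | ⟨b, r, hb, hf⟩ | ⟨b, t, hb, ht, hf⟩⟩ :=
    A.classification
  · exact ⟨h', α', β', a, b, A', ha, hb, hf⟩
  · exact (hL ⟨_, hf.hasKillingRatio A'.ortho A'.normal hb⟩).elim
  · exact (hL ⟨_, hf.hasKillingRatio A'.ortho A'.normal hb ht⟩).elim

/-- The bound κ ≤ 1 excludes Heisenberg frames, whose ratio is 3/2; product frames have no ratio. -/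
theorem exists_rotationFrame_of_hasKillingRatio (A : IsAdapted g F h α β)
    (hL : HasKillingRatio L κ) (hκ : κ ≤ 1) : ∃ h' α' β' b r, IsAdapted g F h' α' β' ∧ b ≠ 0 ∧
      1 - 2 * r ^ 2 / b ^ 2 = κ ∧ IsRotationFrame h' b r := by
  obtain ⟨h', α', β', A', ⟨a, b, ha, hb, hf⟩ | ⟨b, r, hb, hf⟩ | ⟨b, t, hb, ht, hf⟩⟩ :=
    A.classification
  · exact (hf.not_hasKillingRatio A'.ortho A'.normal ha hb hL).elim
  · exact ⟨h', α', β', b, r, A', hb, (hf.hasKillingRatio A'.ortho A'.normal hb).unique hL, hf⟩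
  · have := (hf.hasKillingRatio A'.ortho A'.normal hb ht).unique hL
    linarith

theorem exists_heisenbergFrame_of_hasKillingRatio (A : IsAdapted g F h α β)
    (hL : HasKillingRatio L (3 / 2)) : ∃ h' α' β' b t, IsAdapted g F h' α' β' ∧ b ≠ 0 ∧
      t ^ 2 = b ^ 2 ∧ IsHeisenbergFrame h' b t := by
  obtain ⟨h', α', β', A', ⟨a, b, ha, hb, hf⟩ | ⟨b, r, hb, hf⟩ | ⟨b, t, hb, ht, hf⟩⟩ :=
    A.classification
  · exact (hf.not_hasKillingRatio A'.ortho A'.normal ha hb hL).elim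
  · have := (hf.hasKillingRatio A'.ortho A'.normal hb).unique hL
    have : 0 ≤ 2 * r ^ 2 / b ^ 2 := by positivity
    linarith
  · exact ⟨h', α', β', b, t, A', hb, ht, hf⟩

end IsAdapted

namespace IsTwoA2

variable (he : IsTwoA2 e) (hL : finrank ℝ L = 4)
include he

theorem isSolution_of_equivTo {a₁₂ a₃₄ a₅ : ℝ} (ha : a₅ = (1 + a₃₄ ^ 2) / (1 + a₁₂ ^ 2))
    (ha1 : a₅ ≠ 1)
    (E : EquivTo g F e (Matrix.diagonal ![1, 1, a₅, 1]) (a₁₂ • wedge 0 1 + a₃₄ • wedge 2 3))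
    (o : Basis (Fin 4) ℝ L) : IsSolution g o F := by
  obtain ⟨h, α, β, a, b, A, -⟩ := E.exists_productFrame he ha ha1
  exact A.isSolution o

theorem exists_isSolution (o : Basis (Fin 4) ℝ L) : ∃ g F, IsSolution g o F := by
  obtain ⟨g, F, E⟩ := exists_equivTo e ![1, 1, 2, 1] (by intro i; fin_cases i <;> simp)
    ((0 : ℝ) • wedge 0 1 + (1 : ℝ) • wedge 2 3)
  exact ⟨g, F, he.isSolution_of_equivTo (by norm_num) (by norm_num) E o⟩

include hL

theorem isSolution_iff : IsSolution g e F ↔ ∃ a₁₂ a₃₄ a₅ : ℝ,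
    a₅ = (1 + a₃₄ ^ 2) / (1 + a₁₂ ^ 2) ∧ a₅ ≠ 1 ∧
      EquivTo g F e (Matrix.diagonal ![1, 1, a₅, 1]) (a₁₂ • wedge 0 1 + a₃₄ • wedge 2 3) := by
  refine ⟨fun hs => ?_, fun ⟨_, _, _, ha, ha1, E⟩ => he.isSolution_of_equivTo ha ha1 E e⟩
  obtain ⟨h₀, α₀, β₀, A₀⟩ := hs.exists_adapted hL
  obtain ⟨h, α, β, a, b, A, ha, hb, hf⟩ :=
    A₀.exists_productFrame fun ⟨_, hκ⟩ => he.not_hasKillingRatio hκ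
  obtain ⟨f, hfe, hg, hF⟩ := hf.exists_twoA2 A.ortho A.normal ha hb
  have heq := A.product_eq hf
  refine ⟨α / a, β / b, a ^ 2 / b ^ 2, ?_, ?_, equivTo_of_basis he.lie_eq hfe.lie_eq
    (inv_pos.mpr (abs_pos.mpr ha)) hg hF⟩
  · have hpos : 0 < a ^ 2 + α ^ 2 := by positivity
    have : 1 + (α / a) ^ 2 = (a ^ 2 + α ^ 2) / a ^ 2 := by field_simp
    rw [this]
    field_simp
    linear_combination -heq
  · intro h1
    rw [div_eq_one_iff_eq (by positivity)] at h1
    exact A.ne (by linarith)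

theorem exists_isKahler (hs : IsSolution g e F) : ∃ J, IsKahler g e J := by
  obtain ⟨_, _, _, ha, ha1, E⟩ := (he.isSolution_iff hL).mp hs
  obtain ⟨h, α, β, a, b, A, hf⟩ := E.exists_productFrame he ha ha1
  exact A.exists_isKahler e fun _ hε => hf.isIntegrable hε

end IsTwoA2

namespace IsA2Sum2A1

variable (he : IsA2Sum2A1 e) (hL : finrank ℝ L = 4)
include he

theorem isSolution_of_equivTo {a₁₂ a₃₄ : ℝ} (ha : a₃₄ ^ 2 - a₁₂ ^ 2 = 1)
    (E : EquivTo g F e 1 (a₁₂ • wedge 0 1 + a₃₄ • wedge 2 3)) (o : Basis (Fin 4) ℝ L) :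
    IsSolution g o F := by
  obtain ⟨h, α, β, b, r, A, -⟩ := E.exists_rotationFrame_of_a2Sum2A1 he ha
  exact A.isSolution o

theorem exists_isSolution (o : Basis (Fin 4) ℝ L) : ∃ g F, IsSolution g o F := by
  obtain ⟨g, F, E⟩ := exists_equivTo e (fun _ => 1) (by simp) ((0 : ℝ) • wedge 0 1 + (1 : ℝ) • wedge 2 3)
  rw [Matrix.diagonal_one] at E
  exact ⟨g, F, he.isSolution_of_equivTo (by norm_num) E o⟩

include hL

theorem isSolution_iff : IsSolution g e F ↔ ∃ a₁₂ a₃₄ : ℝ, a₃₄ ^ 2 - a₁₂ ^ 2 = 1 ∧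
    EquivTo g F e 1 (a₁₂ • wedge 0 1 + a₃₄ • wedge 2 3) := by
  refine ⟨fun hs => ?_, fun ⟨_, _, ha, E⟩ => he.isSolution_of_equivTo ha E e⟩
  obtain ⟨h₀, α₀, β₀, A₀⟩ := hs.exists_adapted hL
  obtain ⟨h, α, β, b, r, A, hb, hr, hf⟩ :=
    A₀.exists_rotationFrame_of_hasKillingRatio he.hasKillingRatio le_rfl
  obtain rfl : r = 0 := by
    field_simp at hr
    exact pow_eq_zero_iff two_ne_zero |>.mp (by linarith)
  obtain ⟨f, hfe, hg, hF⟩ := hf.exists_a2Sum2A1 A.ortho A.normal hb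
  have heq := A.rotation_eq hf
  refine ⟨β / b, α / |b|, ?_, equivTo_of_basis he.lie_eq hfe.lie_eq
    (inv_pos.mpr (abs_pos.mpr hb)) hg hF⟩
  rw [div_pow, div_pow, sq_abs, ← sub_div, heq, div_self (pow_ne_zero 2 hb)]

theorem exists_isKahler (hs : IsSolution g e F) : ∃ J, IsKahler g e J := by
  obtain ⟨_, _, ha, E⟩ := (he.isSolution_iff hL).mp hs
  obtain ⟨h, α, β, b, r, A, hf⟩ := E.exists_rotationFrame_of_a2Sum2A1 he ha
  exact A.exists_isKahler e fun _ hε => hf.isIntegrable hε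

end IsA2Sum2A1

namespace IsA46

variable (he : IsA46 a e) (ha0 : a ≠ 0) (hL : finrank ℝ L = 4)
include he ha0

theorem isSolution_of_equivTo {a₁₄ a₂₃ : ℝ} (ha : a₂₃ ^ 2 - a₁₄ ^ 2 = a ^ 2)
    (E : EquivTo g F e 1 (a₁₄ • wedge 0 3 + a₂₃ • wedge 1 2)) (o : Basis (Fin 4) ℝ L) :
    IsSolution g o F := by
  obtain ⟨h, α, β, b, r, A, -⟩ := E.exists_rotationFrame_of_a46 he ha0 ha
  exact A.isSolution o

theorem exists_isSolution (o : Basis (Fin 4) ℝ L) : ∃ g F, IsSolution g o F := by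
  obtain ⟨g, F, E⟩ := exists_equivTo e (fun _ => 1) (by simp) ((0 : ℝ) • wedge 0 3 + a • wedge 1 2)
  rw [Matrix.diagonal_one] at E
  exact ⟨g, F, he.isSolution_of_equivTo ha0 (by ring) E o⟩

include hL

theorem isSolution_iff : IsSolution g e F ↔ ∃ a₁₄ a₂₃ : ℝ, a₂₃ ^ 2 - a₁₄ ^ 2 = a ^ 2 ∧
    EquivTo g F e 1 (a₁₄ • wedge 0 3 + a₂₃ • wedge 1 2) := by
  refine ⟨fun hs => ?_, fun ⟨_, _, ha, E⟩ => he.isSolution_of_equivTo ha0 ha E e⟩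
  obtain ⟨h₀, α₀, β₀, A₀⟩ := hs.exists_adapted hL
  obtain ⟨h, α, β, b, r, A, hb, hr, hf⟩ := A₀.exists_rotationFrame_of_hasKillingRatio
    (he.hasKillingRatio ha0) (sub_le_self _ (by positivity))
  -- The Killing ratios 1 − 2r²/b² of the frame and 1 − 2/a² of the algebra coincide.
  have har : a ^ 2 * r ^ 2 = b ^ 2 := by
    field_simp at hr
    linarith
  obtain ⟨f, hfe, hg, hF⟩ := hf.exists_a46 A.ortho A.normal hb ha0 har
  have heq := A.rotation_eq hf
  refine ⟨_, _, ?_, equivTo_of_basis he.lie_eq hfe.lie_eq (abs_pos.mpr (div_ne_zero ha0 hb)) hg hF⟩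
  rw [mul_pow, mul_pow, neg_sq, sq_abs]
  have hν : (a / b * r) ^ 2 = 1 := by
    field_simp
    linarith
  rw [hν, one_mul, mul_pow, ← mul_sub, heq]
  field_simp

theorem exists_isKahler (hs : IsSolution g e F) : ∃ J, IsKahler g e J := by
  obtain ⟨_, _, ha, E⟩ := (he.isSolution_iff ha0 hL).mp hs
  obtain ⟨h, α, β, b, r, A, hf⟩ := E.exists_rotationFrame_of_a46 he ha0 ha
  exact A.exists_isKahler e fun _ hε => hf.isIntegrable hε

end IsA46

namespace IsA49

variable (he : IsA49 e) (hL : finrank ℝ L = 4)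
include he

theorem isSolution_of_equivTo {a₁₃ a₂₄ : ℝ} (ha : a₁₃ ^ 2 - a₂₄ ^ 2 = 3 / 2)
    (E : EquivTo g F e 1 (a₁₃ • wedge 0 2 + a₂₄ • wedge 1 3)) (o : Basis (Fin 4) ℝ L) :
    IsSolution g o F := by
  obtain ⟨f, h, α, β, t, -, -, -, A, -⟩ := E.exists_heisenbergFrame he ha
  exact A.isSolution o

theorem exists_isSolution (o : Basis (Fin 4) ℝ L) : ∃ g F, IsSolution g o F := by
  -- A rational point of the hyperbola: (5/4)² − (1/4)² = 3/2.
  obtain ⟨g, F, E⟩ := exists_equivTo e (fun _ => 1) (by simp)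
    ((5 / 4 : ℝ) • wedge 0 2 + (1 / 4 : ℝ) • wedge 1 3)
  rw [Matrix.diagonal_one] at E
  exact ⟨g, F, he.isSolution_of_equivTo (by norm_num) E o⟩

include hL

theorem isSolution_iff : IsSolution g e F ↔ ∃ a₁₃ a₂₄ : ℝ, a₁₃ ^ 2 - a₂₄ ^ 2 = 3 / 2 ∧
    EquivTo g F e 1 (a₁₃ • wedge 0 2 + a₂₄ • wedge 1 3) := by
  refine ⟨fun hs => ?_, fun ⟨_, _, ha, E⟩ => he.isSolution_of_equivTo ha E e⟩
  obtain ⟨h₀, α₀, β₀, A₀⟩ := hs.exists_adapted hL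
  obtain ⟨h, α, β, b, t, A, hb, ht, hf⟩ :=
    A₀.exists_heisenbergFrame_of_hasKillingRatio he.hasKillingRatio
  obtain ⟨f, hfe, hg, hF⟩ := hf.exists_a49 A.ortho A.normal hb ht
  have heq := A.heisenberg_eq hf ht
  refine ⟨t * α / b ^ 2, β / b, ?_, equivTo_of_basis he.lie_eq hfe.lie_eq
    (inv_pos.mpr (abs_pos.mpr hb)) hg hF⟩
  rw [div_pow, mul_pow, ht]
  field_simp
  linarith

/-- Every non-Einstein solution comes from a positively oriented Heisenberg frame. -/
theorem exists_oriented_heisenbergFrame (hs : IsSolution g e F) :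
    ∃ (h : Basis (Fin 4) ℝ L) (α β t : ℝ), t ≠ 0 ∧ 0 < h.det e ∧ IsAdapted g F h α β ∧
      IsHeisenbergFrame h (-t) t := by
  obtain ⟨_, _, ha, E⟩ := (he.isSolution_iff hL).mp hs
  obtain ⟨f, h, α, β, t, hf, ht, hh, A, hb⟩ := E.exists_heisenbergFrame he ha
  refine ⟨h, α, β, t, ht.ne', ?_, A, hb⟩
  have h2 : e.det h = t ^ 4 * e.det f := by
    simp only [Basis.det_apply, det_fin_four, Basis.toMatrix_apply, hh, map_smul,
      Finsupp.smul_apply, smul_eq_mul, Matrix.cons_val]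
    ring
  have h3 : 0 < e.det h := by
    rw [h2]
    exact mul_pos (pow_pos ht 4) (he.det_pos hf)
  exact pos_of_mul_pos_right (by rw [det_mul_det]; exact one_pos) h3.le

theorem strictlyAlmostKahler (hs : IsSolution g e F) :
    (∃ J, IsAlmostKahler g e J ∧ ¬ IsIntegrable J ∧
      ∀ x y, g.ricci (J x) (J y) = g.ricci x y) ∧
    (¬ ∃ J, IsKahler g e J) ∧
    (∃ J, IsKahler g (e.reindex (Equiv.swap 0 1)) J) := by
  obtain ⟨h, α, β, t, ht, hpos, A, hb⟩ := he.exists_oriented_heisenbergFrame hL hs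
  have hK : ∀ J, ¬IsKahler g e J := fun J => hb.not_isKahler A.ortho ht hpos
  have hJ : IsAlmostKahler g e (frameJ h 1) :=
    isAlmostKahler_frameJ A.ortho A.closed01 A.closed23 (by norm_num) (by simpa using hpos)
  refine ⟨⟨frameJ h 1, hJ, fun hi => hK _ ⟨hJ, hi⟩, A.ricci_frameJ (by norm_num)⟩,
    fun ⟨J, hJ⟩ => hK J hJ, frameJ h (-1),
    isAlmostKahler_frameJ A.ortho A.closed01 A.closed23 (by norm_num) ?_, hb.isIntegrable⟩
  have : h.det (e.reindex (Equiv.swap 0 1)) = -h.det e := by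
    rw [Basis.coe_reindex, Equiv.symm_swap]
    exact h.det.map_swap e (by decide)
  rw [this]
  linarith

end IsA49

theorem exists_isSolution_iff (hL : finrank ℝ L = 4) (o : Basis (Fin 4) ℝ L) :
    (∃ (g : Metric L) (F : LinearMap.BilinForm ℝ L), IsSolution g o F) ↔
      ((∃ e : Basis (Fin 4) ℝ L, IsTwoA2 e) ∨
        (∃ e : Basis (Fin 4) ℝ L, IsA2Sum2A1 e) ∨
        (∃ (a : ℝ) (e : Basis (Fin 4) ℝ L), a ≠ 0 ∧ IsA46 a e) ∨
        (∃ e : Basis (Fin 4) ℝ L, IsA49 e)) := by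
  constructor
  · rintro ⟨g, F, hs⟩
    obtain ⟨h₀, α₀, β₀, A₀⟩ := hs.exists_adapted hL
    obtain ⟨h, α, β, A, ⟨a, b, ha, hb, hf⟩ | ⟨b, r, hb, hf⟩ | ⟨b, t, hb, ht, hf⟩⟩ :=
      A₀.classification
    · obtain ⟨f, hf, -⟩ := hf.exists_twoA2 A.ortho A.normal ha hb
      exact Or.inl ⟨f, hf⟩
    -- Without rotation the algebra is 𝒜₂ ⊕ 2𝒜₁; otherwise it is 𝒜₄,₆ with a = b/r.
    · by_cases hr : r = 0
      · subst hr
        obtain ⟨f, hf, -⟩ := hf.exists_a2Sum2A1 A.ortho A.normal hb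
        exact Or.inr (Or.inl ⟨f, hf⟩)
      · have ha : b / r ≠ 0 := div_ne_zero hb hr
        obtain ⟨f, hf, -⟩ := hf.exists_a46 A.ortho A.normal hb ha (by field_simp)
        exact Or.inr (Or.inr (Or.inl ⟨_, f, ha, hf⟩))
    · obtain ⟨f, hf, -⟩ := hf.exists_a49 A.ortho A.normal hb ht
      exact Or.inr (Or.inr (Or.inr ⟨f, hf⟩))
  · rintro (⟨e, he⟩ | ⟨e, he⟩ | ⟨a, e, ha, he⟩ | ⟨e, he⟩)
    · exact he.exists_isSolution o
    · exact he.exists_isSolution o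
    · exact he.exists_isSolution ha o
    · exact he.exists_isSolution o

end EinsteinMaxwell

theorem theorem1 {L : Type*} [LieRing L] [LieAlgebra ℝ L] [FiniteDimensional ℝ L]
    (hL : Module.finrank ℝ L = 4) :
    -- the algebras admitting a non-Einstein solution (for any orientation)
    (∀ o : Module.Basis (Fin 4) ℝ L,
      (∃ (g : Metric L) (F : LinearMap.BilinForm ℝ L), IsSolution g o F) ↔
        ((∃ e : Module.Basis (Fin 4) ℝ L, IsTwoA2 e) ∨
          (∃ e : Module.Basis (Fin 4) ℝ L, IsA2Sum2A1 e) ∨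
          (∃ (a : ℝ) (e : Module.Basis (Fin 4) ℝ L), a ≠ 0 ∧ IsA46 a e) ∨
          (∃ e : Module.Basis (Fin 4) ℝ L, IsA49 e))) ∧
    -- the solutions on each of them
    (∀ e : Module.Basis (Fin 4) ℝ L, IsTwoA2 e →
      ∀ (g : Metric L) (F : LinearMap.BilinForm ℝ L),
        (IsSolution g e F ↔ ∃ a₁₂ a₃₄ a₅ : ℝ,
          a₅ = (1 + a₃₄ ^ 2) / (1 + a₁₂ ^ 2) ∧ a₅ ≠ 1 ∧
          EquivTo g F e (Matrix.diagonal ![1, 1, a₅, 1])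
            (a₁₂ • wedge 0 1 + a₃₄ • wedge 2 3)) ∧
        (IsSolution g e F → ∃ J, IsKahler g e J)) ∧
    (∀ e : Module.Basis (Fin 4) ℝ L, IsA2Sum2A1 e →
      ∀ (g : Metric L) (F : LinearMap.BilinForm ℝ L),
        (IsSolution g e F ↔ ∃ a₁₂ a₃₄ : ℝ, a₃₄ ^ 2 - a₁₂ ^ 2 = 1 ∧
          EquivTo g F e 1 (a₁₂ • wedge 0 1 + a₃₄ • wedge 2 3)) ∧
        (IsSolution g e F → ∃ J, IsKahler g e J)) ∧
    (∀ (a : ℝ) (e : Module.Basis (Fin 4) ℝ L), a ≠ 0 → IsA46 a e →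
      ∀ (g : Metric L) (F : LinearMap.BilinForm ℝ L),
        (IsSolution g e F ↔ ∃ a₁₄ a₂₃ : ℝ, a₂₃ ^ 2 - a₁₄ ^ 2 = a ^ 2 ∧
          EquivTo g F e 1 (a₁₄ • wedge 0 3 + a₂₃ • wedge 1 2)) ∧
        (IsSolution g e F → ∃ J, IsKahler g e J)) ∧
    (∀ e : Module.Basis (Fin 4) ℝ L, IsA49 e →
      ∀ (g : Metric L) (F : LinearMap.BilinForm ℝ L),
        (IsSolution g e F ↔ ∃ a₁₃ a₂₄ : ℝ, a₁₃ ^ 2 - a₂₄ ^ 2 = 3 / 2 ∧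
          EquivTo g F e 1 (a₁₃ • wedge 0 2 + a₂₄ • wedge 1 3)) ∧
        -- strictly almost-Kähler, with J-invariant Ricci tensor, for the orientation e¹²³⁴;
        -- Kähler for the reversed orientation
        (IsSolution g e F →
          (∃ J, IsAlmostKahler g e J ∧ ¬ IsIntegrable J ∧
            ∀ x y, g.ricci (J x) (J y) = g.ricci x y) ∧
          (¬ ∃ J, IsKahler g e J) ∧
          (∃ J, IsKahler g (e.reindex (Equiv.swap 0 1)) J))) :=
  ⟨exists_isSolution_iff hL,
    fun _ he _ _ => ⟨he.isSolution_iff hL, he.exists_isKahler hL⟩,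
    fun _ he _ _ => ⟨he.isSolution_iff hL, he.exists_isKahler hL⟩,
    fun _ _ ha he _ _ => ⟨he.isSolution_iff ha hL, he.exists_isKahler ha hL⟩,
    fun _ he _ _ => ⟨he.isSolution_iff hL, he.strictlyAlmostKahler hL⟩⟩
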